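/- Let $\mathbb{K}$ be a field of characteristic zero. For a finite set $V$ let $\mathbf{G}[V]$ be the set of simple graphs (no loops, no multiple edges) with vertex set $V$ if $V\neq\emptyset$, and $\mathbf{G}[\emptyset]=\emptyset$. Let $\mathbb{K}\mathbf{G}$ be the linear symmetric operad with $\mathbb{K}\mathbf{G}[V]$ the space with basis $\mathbf{G}[V]$, with the one-vertex graphs as units, and with partial composition given, for disjoint $V_1\ni\ast$ and $V_2$, $g_1\in\mathbf{G}[V_1]$ and $g_2\in\mathbf{G}[V_2]$, by $$g_1\circ_\ast g_2=\sum_{f:N_\ast\to V_2}(g_1\setminus\{\ast\})\cup g_2\cup\bigcup_{v\in N_\ast}\{\{v,f(v)\}\},$$ where $N_\ast$ is the set of neighbours of $\ast$ in $g_1$. Let $\mathbf{ComMag}$ be the set operad for which $\mathbf{ComMag}[V]$ is the set of nonplanar binary trees whose set of leaves is $V$, the partial composition $s\circ_\ast t$ being the grafting of $t$ on the leaf $\ast$ of $s$, and let $\mathbb{K}\mathbf{ComMag}$ be its linear extension. Let $a\neq b$. The suboperad of $\mathbb{K}\mathbf{G}$ generated by the graph on $\{a,b\}$ with a single edge is isomorphic,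 as a linear operad, to $\mathbb{K}\mathbf{ComMag}$. Here $\mathbb{K}\mathbf{ComMag}$ is the free operad on one symmetric binary generator: the tree with two leaves $a,b$ is invariant under all bijections of $\{a,b\}$, and for every linear operad $P$ over $\mathbb{K}$ and every $x\in P[\{a,b\}]$ invariant under all bijections of $\{a,b\}$, there is exactly one operad morphism $\mathbb{K}\mathbf{ComMag}\to P$ that sends this tree to $x$. -/

import Mathlib

universe u v w w'

namespace GraphOperad

/-! ### Relabelling bijections -/

/-- `(A ⊔ {*}) ⊔ B ≃ (A ⊔ B) ⊔ {*}`. -/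
def starLeft (A B : Type v) : Option A ⊕ B ≃ Option (A ⊕ B) where
  toFun
    | .inl none => none
    | .inl (some a) => some (.inl a)
    | .inr b => some (.inr b)
  invFun
    | none => .inl none
    | some (.inl a) => .inl (some a)
    | some (.inr b) => .inr b
  left_inv := by rintro ((_ | _) | _) <;> rfl
  right_inv := by rintro (_ | _ | _) <;> rfl

/-- `A ⊔ (B ⊔ {*}) ≃ (A ⊔ B) ⊔ {*}`. -/
def starRight (A B : Type v) : A ⊕ Option B ≃ Option (A ⊕ B) where
  toFun
    | .inl a => some (.inl a)
    | .inr none => none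
    | .inr (some b) => some (.inr b)
  invFun
    | none => .inr none
    | some (.inl a) => .inl a
    | some (.inr b) => .inr (some b)
  left_inv := by rintro (_ | (_ | _)) <;> rfl
  right_inv := by rintro (_ | _ | _) <;> rfl

/-- The exchange of the two added points of `A ⊔ {*₂} ⊔ {*₁}`. -/
def starSwap (A : Type v) : Option (Option A) ≃ Option (Option A) where
  toFun
    | none => some none
    | some none => none
    | some (some a) => some (some a)
  invFun
    | none => some none
    | some none => none
    | some (some a) => some (some a)
  left_inv := by rintro (_ | _ | _) <;> rfl
  right_inv := by rintro (_ | _ | _) <;> rfl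

/-- `(A ⊔ C) ⊔ B ≃ (A ⊔ B) ⊔ C`. -/
def sumSwapRight (A B C : Type v) : (A ⊕ C) ⊕ B ≃ (A ⊕ B) ⊕ C where
  toFun
    | .inl (.inl a) => .inl (.inl a)
    | .inl (.inr c) => .inr c
    | .inr b => .inl (.inr b)
  invFun
    | .inl (.inl a) => .inl (.inl a)
    | .inl (.inr b) => .inr b
    | .inr c => .inl (.inr c)
  left_inv := by rintro ((_ | _) | _) <;> rfl
  right_inv := by rintro ((_ | _) | _) <;> rfl

/-! ### Species -/

/-- A set species: a functor from finite sets and bijections to sets. -/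
structure SetSpecies where
  obj : (V : Type v) → [Finite V] → Type w
  map : {V W : Type v} → [Finite V] → [Finite W] → (V ≃ W) → obj V → obj W
  map_refl : ∀ {V : Type v} [Finite V] (x : obj V), map (Equiv.refl V) x = x
  map_trans : ∀ {U V W : Type v} [Finite U] [Finite V] [Finite W] (σ : U ≃ V) (τ : V ≃ W)
    (x : obj U), map (σ.trans τ) x = map τ (map σ x)

/-- A linear species over `K`: a functor from finite sets and bijections to `K`-vector spaces. -/
structure LinearSpecies (K : Type u) [Field K] where
  obj : (V : Type v) → [Finite V] → Type w
  [addCommGroup : ∀ (V : Type v) [Finite V], AddCommGroup (obj V)]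
  [module : ∀ (V : Type v) [Finite V], Module K (obj V)]
  map : {V W : Type v} → [Finite V] → [Finite W] → (V ≃ W) → (obj V →ₗ[K] obj W)
  map_refl : ∀ {V : Type v} [Finite V] (x : obj V), map (Equiv.refl V) x = x
  map_trans : ∀ {U V W : Type v} [Finite U] [Finite V] [Finite W] (σ : U ≃ V) (τ : V ≃ W)
    (x : obj U), map (σ.trans τ) x = map τ (map σ x)

attribute [instance] LinearSpecies.addCommGroup LinearSpecies.module

/-! ### Operads

The derivative of a species `O` has `O'[A] = O[A ⊔ {*}]`, here `obj (Option A)`, the added point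
`*` being `none`. The partial composition is given by its components
`O[A ⊔ {*}] ⊗ O[B] → O[A ⊔ B]`, natural in `A` and `B`. The unit is given by an element
of `O[V]` for every one-point set `V`, natural in `V`. -/

/-- A symmetric set operad. -/
structure SetOperad extends SetSpecies.{v, w} where
  positive : ∀ (V : Type v) [IsEmpty V], IsEmpty (obj V)
  unit : (V : Type v) → [Unique V] → obj V
  unit_natural : ∀ {V W : Type v} [Unique V] [Unique W] (σ : V ≃ W), map σ (unit V) = unit W
  circ : {A B : Type v} → [Finite A] → [Finite B] → obj (Option A) → obj B → obj (A ⊕ B)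
  circ_natural : ∀ {A A' B B' : Type v} [Finite A] [Finite A'] [Finite B] [Finite B']
    (σ : A ≃ A') (τ : B ≃ B') (x : obj (Option A)) (y : obj B),
    circ (map (Equiv.optionCongr σ) x) (map τ y) = map (Equiv.sumCongr σ τ) (circ x y)
  /-- Parallel associativity: `(x ∘_{*₁} y) ∘_{*₂} z = (x ∘_{*₂} z) ∘_{*₁} y`. -/
  circ_parallel : ∀ {A B C : Type v} [Finite A] [Finite B] [Finite C]
    (x : obj (Option (Option A))) (y : obj B) (z : obj C),
    circ (map (starLeft A B) (circ x y)) z =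
      map (sumSwapRight A B C) (circ (map (starLeft A C) (circ (map (starSwap A) x) z)) y)
  /-- Sequential associativity: `(x ∘_{*₁} y) ∘_{*₂} z = x ∘_{*₁} (y ∘_{*₂} z)`. -/
  circ_sequential : ∀ {A B C : Type v} [Finite A] [Finite B] [Finite C]
    (x : obj (Option A)) (y : obj (Option B)) (z : obj C),
    map (Equiv.sumAssoc A B C) (circ (map (starRight A B) (circ x y)) z) = circ x (circ y z)
  circ_unit : ∀ {A B : Type v} [Finite A] [Unique B] (x : obj (Option A)),
    map (Equiv.sumCongr (Equiv.refl A) (Equiv.equivPUnit.{_, v + 1} B))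
      (circ x (unit B)) = map (Equiv.optionEquivSumPUnit A) x
  unit_circ : ∀ {A B : Type v} [IsEmpty A] [Finite B] (y : obj B),
    circ (unit (Option A)) y = map (Equiv.emptySum A B).symm y

/-- A symmetric linear operad. -/
structure LinearOperad (K : Type u) [Field K] extends LinearSpecies.{u, v, w} K where
  positive : ∀ (V : Type v) [IsEmpty V], Subsingleton (obj V)
  unit : (V : Type v) → [Unique V] → obj V
  unit_natural : ∀ {V W : Type v} [Unique V] [Unique W] (σ : V ≃ W), map σ (unit V) = unit W
  circ : {A B : Type v} → [Finite A] → [Finite B] →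
    (obj (Option A) →ₗ[K] obj B →ₗ[K] obj (A ⊕ B))
  circ_natural : ∀ {A A' B B' : Type v} [Finite A] [Finite A'] [Finite B] [Finite B']
    (σ : A ≃ A') (τ : B ≃ B') (x : obj (Option A)) (y : obj B),
    circ (map (Equiv.optionCongr σ) x) (map τ y) = map (Equiv.sumCongr σ τ) (circ x y)
  /-- Parallel associativity: `(x ∘_{*₁} y) ∘_{*₂} z = (x ∘_{*₂} z) ∘_{*₁} y`. -/
  circ_parallel : ∀ {A B C : Type v} [Finite A] [Finite B] [Finite C]
    (x : obj (Option (Option A))) (y : obj B) (z : obj C),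
    circ (map (starLeft A B) (circ x y)) z =
      map (sumSwapRight A B C) (circ (map (starLeft A C) (circ (map (starSwap A) x) z)) y)
  /-- Sequential associativity: `(x ∘_{*₁} y) ∘_{*₂} z = x ∘_{*₁} (y ∘_{*₂} z)`. -/
  circ_sequential : ∀ {A B C : Type v} [Finite A] [Finite B] [Finite C]
    (x : obj (Option A)) (y : obj (Option B)) (z : obj C),
    map (Equiv.sumAssoc A B C) (circ (map (starRight A B) (circ x y)) z) = circ x (circ y z)
  circ_unit : ∀ {A B : Type v} [Finite A] [Unique B] (x : obj (Option A)),
    map (Equiv.sumCongr (Equiv.refl A) (Equiv.equivPUnit.{_, v + 1} B))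
      (circ x (unit B)) = map (Equiv.optionEquivSumPUnit A) x
  unit_circ : ∀ {A B : Type v} [IsEmpty A] [Finite B] (y : obj B),
    circ (unit (Option A)) y = map (Equiv.emptySum A B).symm y

/-- A morphism of linear operads. -/
structure LinearOperad.Hom {K : Type u} [Field K] (P : LinearOperad.{u, v, w} K)
    (Q : LinearOperad.{u, v, w'} K) where
  app : (V : Type v) → [Finite V] → (P.obj V →ₗ[K] Q.obj V)
  natural : ∀ {V W : Type v} [Finite V] [Finite W] (σ : V ≃ W) (x : P.obj V),
    app W (P.map σ x) = Q.map σ (app V x)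
  app_unit : ∀ (V : Type v) [Unique V], app V (P.unit V) = Q.unit V
  app_circ : ∀ {A B : Type v} [Finite A] [Finite B] (x : P.obj (Option A)) (y : P.obj B),
    app (A ⊕ B) (P.circ x y) = Q.circ (app (Option A) x) (app B y)

/-- An isomorphism of linear operads: a morphism with an inverse morphism. -/
structure LinearOperad.Iso {K : Type u} [Field K] (P : LinearOperad.{u, v, w} K)
    (Q : LinearOperad.{u, v, w'} K) where
  hom : P.Hom Q
  inv : Q.Hom P
  hom_inv : ∀ (V : Type v) [Finite V] (x : P.obj V), inv.app V (hom.app V x) = x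
  inv_hom : ∀ (V : Type v) [Finite V] (y : Q.obj V), hom.app V (inv.app V y) = y

/-- A suboperad of a linear operad: a family of subspaces stable under relabelling and partial
composition and containing the units. -/
structure LinearOperad.Suboperad {K : Type u} [Field K] (P : LinearOperad.{u, v, w} K) where
  carrier : (V : Type v) → [Finite V] → Submodule K (P.obj V)
  map_mem : ∀ {V W : Type v} [Finite V] [Finite W] (σ : V ≃ W) (x : P.obj V),
    x ∈ carrier V → P.map σ x ∈ carrier W
  unit_mem : ∀ (V : Type v) [Unique V], P.unit V ∈ carrier V
  circ_mem : ∀ {A B : Type v} [Finite A] [Finite B] (x : P.obj (Option A)) (y : P.obj B),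
    x ∈ carrier (Option A) → y ∈ carrier B → P.circ x y ∈ carrier (A ⊕ B)

/-- A suboperad, as an operad. -/
def LinearOperad.Suboperad.toOperad {K : Type u} [Field K] {P : LinearOperad.{u, v, w} K}
    (S : P.Suboperad) : LinearOperad.{u, v, w} K where
  obj V _ := S.carrier V
  map {V W} _ _ σ := (P.map σ).restrict (S.map_mem σ)
  map_refl x := Subtype.ext (P.map_refl x.1)
  map_trans σ τ x := Subtype.ext (P.map_trans σ τ x.1)
  positive V _ := by
    have := P.positive V
    infer_instance
  unit V _ := ⟨P.unit V, S.unit_mem V⟩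
  unit_natural σ := Subtype.ext (P.unit_natural σ)
  circ {A B} _ _ := LinearMap.mk₂ K
    (fun x y => ⟨P.circ x.1 y.1, S.circ_mem x.1 y.1 x.2 y.2⟩)
    (fun _ _ _ => Subtype.ext (by simp)) (fun _ _ _ => Subtype.ext (by simp))
    (fun _ _ _ => Subtype.ext (by simp)) (fun _ _ _ => Subtype.ext (by simp))
  circ_natural σ τ x y := Subtype.ext (P.circ_natural σ τ x.1 y.1)
  circ_parallel x y z := Subtype.ext (P.circ_parallel x.1 y.1 z.1)
  circ_sequential x y z := Subtype.ext (P.circ_sequential x.1 y.1 z.1)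
  circ_unit x := Subtype.ext (P.circ_unit x.1)
  unit_circ y := Subtype.ext (P.unit_circ y.1)

/-- The smallest suboperad containing a family of elements `x i ∈ P[V i]`. -/
def LinearOperad.generated {K : Type u} [Field K] (P : LinearOperad.{u, v, w} K)
    {ι : Type*} (V : ι → Type v) [∀ i, Finite (V i)] (x : ∀ i, P.obj (V i)) : P.Suboperad where
  carrier W _ := ⨅ S : {S : P.Suboperad // ∀ i, x i ∈ S.carrier (V i)}, S.1.carrier W
  map_mem σ x hx := by
    rw [Submodule.mem_iInf] at hx ⊢
    exact fun S => S.1.map_mem σ x (hx S)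
  unit_mem V _ := by
    rw [Submodule.mem_iInf]
    exact fun S => S.1.unit_mem V
  circ_mem x y hx hy := by
    rw [Submodule.mem_iInf] at hx hy ⊢
    exact fun S => S.1.circ_mem x y (hx S) (hy S)

/-! ### Linear extension -/

/-- The bilinear extension of a map defined on pairs of basis elements. -/
noncomputable def bilin (K : Type u) [Field K] {X Y : Type*} {M : Type*} [AddCommGroup M]
    [Module K M] (f : X → Y → M) : (X →₀ K) →ₗ[K] (Y →₀ K) →ₗ[K] M :=
  Finsupp.linearCombination K (fun x => Finsupp.linearCombination K (f x))

theorem bilin_single {K : Type u} [Field K] {X Y M : Type*} [AddCommGroup M]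
    [Module K M] (f : X → Y → M) (x : X) (y : Y) (r s : K) :
    bilin K f (Finsupp.single x r) (Finsupp.single y s) = r • s • f x y := by
  simp [bilin]

/-- The relabelling of the formal linear combinations of elements of a set species. -/
noncomputable def SetSpecies.linMap (K : Type u) [Field K] (S : SetSpecies.{v, w})
    {V W : Type v} [Finite V] [Finite W] (σ : V ≃ W) : (S.obj V →₀ K) →ₗ[K] (S.obj W →₀ K) :=
  Finsupp.lmapDomain K K (S.map σ)

theorem SetSpecies.linMap_single {K : Type u} [Field K] (S : SetSpecies.{v, w})
    {V W : Type v} [Finite V] [Finite W] (σ : V ≃ W) (x : S.obj V) (r : K) :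
    S.linMap K σ (Finsupp.single x r) = Finsupp.single (S.map σ x) r := by
  simp [SetSpecies.linMap]

/-- The linear species `K S` of formal linear combinations of elements of a set species `S`. -/
noncomputable def SetSpecies.linearize (K : Type u) [Field K] (S : SetSpecies.{v, w}) :
    LinearSpecies.{u, v, max w u} K where
  obj V _ := S.obj V →₀ K
  map σ := S.linMap K σ
  map_refl {V} _ x := by
    have : S.map (Equiv.refl V) = id := funext S.map_refl
    simp [SetSpecies.linMap, this]
  map_trans σ τ x := by
    have : S.map (σ.trans τ) = S.map τ ∘ S.map σ := funext (S.map_trans σ τ)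
    simp [SetSpecies.linMap, this, Finsupp.mapDomain_comp]

/-- A linear operad structure on `K S`, for `S` a set species, given by partial compositions
of basis elements. -/
noncomputable def LinearOperad.ofBasis (K : Type u) [Field K] (S : SetSpecies.{v, w})
    (positive : ∀ (V : Type v) [IsEmpty V], IsEmpty (S.obj V))
    (unit : (V : Type v) → [Unique V] → S.obj V)
    (unit_natural : ∀ {V W : Type v} [Unique V] [Unique W] (σ : V ≃ W),
      S.map σ (unit V) = unit W)
    (c : {A B : Type v} → [Finite A] → [Finite B] → S.obj (Option A) → S.obj B →
      (S.obj (A ⊕ B) →₀ K))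
    (circ_natural : ∀ {A A' B B' : Type v} [Finite A] [Finite A'] [Finite B] [Finite B']
      (σ : A ≃ A') (τ : B ≃ B') (x : S.obj (Option A)) (y : S.obj B),
      c (S.map (Equiv.optionCongr σ) x) (S.map τ y) = S.linMap K (Equiv.sumCongr σ τ) (c x y))
    (circ_parallel : ∀ {A B C : Type v} [Finite A] [Finite B] [Finite C]
      (x : S.obj (Option (Option A))) (y : S.obj B) (z : S.obj C),
      bilin K c (S.linMap K (starLeft A B) (c x y)) (Finsupp.single z 1) =
        S.linMap K (sumSwapRight A B C)
          (bilin K c (S.linMap K (starLeft A C) (c (S.map (starSwap A) x) z))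
            (Finsupp.single y 1)))
    (circ_sequential : ∀ {A B C : Type v} [Finite A] [Finite B] [Finite C]
      (x : S.obj (Option A)) (y : S.obj (Option B)) (z : S.obj C),
      S.linMap K (Equiv.sumAssoc A B C)
        (bilin K c (S.linMap K (starRight A B) (c x y)) (Finsupp.single z 1)) =
        bilin K c (Finsupp.single x 1) (c y z))
    (circ_unit : ∀ {A B : Type v} [Finite A] [Unique B] (x : S.obj (Option A)),
      S.linMap K (Equiv.sumCongr (Equiv.refl A) (Equiv.equivPUnit.{_, v + 1} B))
        (c x (unit B)) = Finsupp.single (S.map (Equiv.optionEquivSumPUnit A) x) 1)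
    (unit_circ : ∀ {A B : Type v} [IsEmpty A] [Finite B] (y : S.obj B),
      c (unit (Option A)) y = Finsupp.single (S.map (Equiv.emptySum A B).symm y) 1) :
    LinearOperad.{u, v, max w u} K where
  toLinearSpecies := S.linearize K
  positive V _ := by
    have := positive V
    change Subsingleton (S.obj V →₀ K)
    infer_instance
  unit V _ := Finsupp.single (unit V) 1
  unit_natural {V W} _ _ σ := by
    have : S.linMap K σ (Finsupp.single (unit V) 1) = Finsupp.single (unit W) 1 := by
      rw [S.linMap_single, unit_natural]
    exact this
  circ := bilin K c
  circ_natural {A A' B B'} _ _ _ _ σ τ := by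
    have (x : S.obj (Option A) →₀ K) (y : S.obj B →₀ K) :
        bilin K c (S.linMap K (Equiv.optionCongr σ) x) (S.linMap K τ y) =
          S.linMap K (Equiv.sumCongr σ τ) (bilin K c x y) := by
      induction x using Finsupp.induction_linear with
      | zero => simp
      | add x x' hx hx' => simp only [map_add, LinearMap.add_apply, hx, hx']
      | single x r =>
        induction y using Finsupp.induction_linear with
        | zero => simp
        | add x x' hx hx' => simp only [map_add, hx, hx']
        | single y s => simp only [S.linMap_single, bilin_single, circ_natural, map_smul]
    exact this
  circ_parallel {A B C} _ _ _ := by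
    have (x : S.obj (Option (Option A)) →₀ K) (y : S.obj B →₀ K) (z : S.obj C →₀ K) :
        bilin K c (S.linMap K (starLeft A B) (bilin K c x y)) z =
          S.linMap K (sumSwapRight A B C) (bilin K c (S.linMap K (starLeft A C)
            (bilin K c (S.linMap K (starSwap A) x) z)) y) := by
      induction x using Finsupp.induction_linear with
      | zero => simp
      | add x x' hx hx' => simp only [map_add, LinearMap.add_apply, hx, hx']
      | single x r =>
        induction y using Finsupp.induction_linear with
        | zero => simp
        | add x x' hx hx' => simp only [map_add, LinearMap.add_apply, hx, hx']
        | single y s =>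
          induction z using Finsupp.induction_linear with
          | zero => simp
          | add x x' hx hx' => simp only [map_add, LinearMap.add_apply, hx, hx']
          | single z t =>
            rw [← mul_one t, ← mul_one s, ← smul_eq_mul, ← smul_eq_mul,
              ← Finsupp.smul_single, ← Finsupp.smul_single]
            simp only [S.linMap_single, bilin_single, map_smul, LinearMap.smul_apply, one_smul]
            rw [circ_parallel]
            simp only [smul_smul]
            congr 1
            ring
    exact this
  circ_sequential {A B C} _ _ _ := by
    have (x : S.obj (Option A) →₀ K) (y : S.obj (Option B) →₀ K) (z : S.obj C →₀ K) :
        S.linMap K (Equiv.sumAssoc A B C)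
          (bilin K c (S.linMap K (starRight A B) (bilin K c x y)) z) =
          bilin K c x (bilin K c y z) := by
      induction x using Finsupp.induction_linear with
      | zero => simp
      | add x x' hx hx' => simp only [map_add, LinearMap.add_apply, hx, hx']
      | single x r =>
        induction y using Finsupp.induction_linear with
        | zero => simp
        | add x x' hx hx' => simp only [map_add, LinearMap.add_apply, hx, hx']
        | single y s =>
          induction z using Finsupp.induction_linear with
          | zero => simp
          | add x x' hx hx' => simp only [map_add, hx, hx']
          | single z t =>
            rw [← mul_one t, ← mul_one r, ← smul_eq_mul, ← smul_eq_mul,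
              ← Finsupp.smul_single, ← Finsupp.smul_single]
            simp only [bilin_single, map_smul, LinearMap.smul_apply, one_smul, circ_sequential]
            simp only [smul_smul]
            congr 1
            ring
    exact this
  circ_unit {A B} _ _ := by
    have (x : S.obj (Option A) →₀ K) :
        S.linMap K (Equiv.sumCongr (Equiv.refl A) (Equiv.equivPUnit.{_, v + 1} B))
          (bilin K c x (Finsupp.single (unit B) 1)) =
          S.linMap K (Equiv.optionEquivSumPUnit A) x := by
      induction x using Finsupp.induction_linear with
      | zero => simp
      | add x x' hx hx' => simp only [map_add, LinearMap.add_apply, hx, hx']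
      | single x r =>
        simp [bilin_single, S.linMap_single, circ_unit]
    exact this
  unit_circ {A B} _ _ := by
    have (y : S.obj B →₀ K) :
        bilin K c (Finsupp.single (unit (Option A)) 1) y =
          S.linMap K (Equiv.emptySum A B).symm y := by
      induction y using Finsupp.induction_linear with
      | zero => simp
      | add x x' hx hx' => simp only [map_add, hx, hx']
      | single y r => simp [bilin_single, S.linMap_single, unit_circ]
    exact this

/-- The linear operad `K S` obtained from a set operad `S` by linear extension. -/
noncomputable def SetOperad.linearize (K : Type u) [Field K] (S : SetOperad.{v, w}) :
    LinearOperad.{u, v, max w u} K :=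
  LinearOperad.ofBasis K S.toSetSpecies S.positive S.unit S.unit_natural
    (fun x y => Finsupp.single (S.circ x y) 1)
    (fun σ τ x y => by rw [S.circ_natural, S.linMap_single])
    (fun x y z => by
      simp only [S.linMap_single, bilin_single, one_smul]
      rw [S.circ_parallel])
    (fun x y z => by
      simp only [S.linMap_single, bilin_single, one_smul]
      rw [S.circ_sequential])
    (fun x => by rw [S.linMap_single, S.circ_unit])
    (fun y => by rw [S.unit_circ])

/-! ### Nonplanar binary trees and the set operad `ComMag` -/

/-- Planar binary trees with leaves labelled by elements of `V`. -/
inductive PlanarTree (V : Type v) : Type v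
  | leaf : V → PlanarTree V
  | node : PlanarTree V → PlanarTree V → PlanarTree V

/-- Two planar binary trees represent the same nonplanar tree: the equivalence relation generated
by exchanging the two subtrees at any internal node. -/
inductive PlanarTree.Equivalent {V : Type v} : PlanarTree V → PlanarTree V → Prop
  | refl (s) : Equivalent s s
  | symm {s t} : Equivalent s t → Equivalent t s
  | trans {s t r} : Equivalent s t → Equivalent t r → Equivalent s r
  | swap (s t) : Equivalent (.node s t) (.node t s)
  | congr {s s' t t'} : Equivalent s s' → Equivalent t t' → Equivalent (.node s t) (.node s' t')

/-- Nonplanar binary trees with leaves labelled by elements of `V`. -/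
def CommTree (V : Type v) : Type v :=
  Quotient (⟨PlanarTree.Equivalent, ⟨.refl, .symm, .trans⟩⟩ : Setoid (PlanarTree V))

namespace CommTree

variable {U V W X : Type v}

/-- The tree reduced to a leaf. -/
def leaf (v : V) : CommTree V := Quotient.mk _ (.leaf v)

/-- The tree with two given subtrees at the root. -/
def node : CommTree V → CommTree V → CommTree V :=
  Quotient.map₂ .node fun _ _ hs _ _ ht => .congr hs ht

theorem node_comm (s t : CommTree V) : node s t = node t s := by
  induction s using Quotient.inductionOn with | _ s
  induction t using Quotient.inductionOn with | _ t
  exact Quotient.sound (.swap s t)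

theorem ind {p : CommTree V → Prop} (hl : ∀ v, p (leaf v))
    (hn : ∀ s t, p s → p t → p (node s t)) (t : CommTree V) : p t := by
  induction t using Quotient.inductionOn with | _ t
  induction t with
  | leaf v => exact hl v
  | node s t hs ht => exact hn _ _ hs ht

/-- Recursion on planar trees. -/
def foldPlanar {M : Type*} (op : M → M → M) (k : V → M) : PlanarTree V → M
  | .leaf v => k v
  | .node s t => op (foldPlanar op k s) (foldPlanar op k t)

/-- Evaluation of a nonplanar binary tree in a set with a commutative binary operation. -/
def fold {M : Type*} (op : M → M → M) (comm : ∀ x y, op x y = op y x) (k : V → M) :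
    CommTree V → M :=
  Quotient.lift (foldPlanar op k) (by
    intro s t h
    induction h with
    | refl => rfl
    | symm _ h => exact h.symm
    | trans _ _ h h' => exact h.trans h'
    | swap s t => exact comm _ _
    | congr _ _ h h' => exact congrArg₂ op h h')

theorem fold_leaf {M : Type*} (op : M → M → M) (comm) (k : V → M) (v : V) :
    fold op comm k (leaf v) = k v := rfl

theorem fold_node {M : Type*} (op : M → M → M) (comm) (k : V → M) (s t : CommTree V) :
    fold op comm k (node s t) = op (fold op comm k s) (fold op comm k t) := by
  induction s using Quotient.inductionOn with | _ s
  induction t using Quotient.inductionOn with | _ t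
  rfl

/-- The multiset of leaf labels. -/
def leaves (t : CommTree V) : Multiset V := fold (· + ·) add_comm (fun v => {v}) t

/-- Grafting of the tree `k v` on each leaf labelled `v`. -/
def graft (t : CommTree V) (k : V → CommTree W) : CommTree W := fold node node_comm k t

@[simp] theorem leaves_leaf (v : V) : leaves (leaf v) = {v} := rfl

@[simp] theorem leaves_node (s t : CommTree V) : leaves (node s t) = leaves s + leaves t :=
  fold_node _ _ _ _ _

@[simp] theorem graft_leaf (v : V) (k : V → CommTree W) : graft (leaf v) k = k v := rfl

@[simp] theorem graft_node (s t : CommTree V) (k : V → CommTree W) :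
    graft (node s t) k = node (graft s k) (graft t k) := fold_node _ _ _ _ _

theorem graft_id (t : CommTree V) : graft t leaf = t := by
  induction t using ind with
  | hl v => rfl
  | hn s t hs ht => rw [graft_node, hs, ht]

theorem graft_graft (t : CommTree U) (k : U → CommTree V) (l : V → CommTree W) :
    graft (graft t k) l = graft t fun u => graft (k u) l := by
  induction t using ind with
  | hl v => rfl
  | hn s t hs ht => simp only [graft_node, hs, ht]

theorem leaves_graft (t : CommTree V) (k : V → CommTree W) :
    leaves (graft t k) = (leaves t).bind fun v => leaves (k v) := by
  induction t using ind with
  | hl v => simp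
  | hn s t hs ht => simp [hs, ht]

theorem exists_mem_leaves (t : CommTree V) : ∃ v, v ∈ leaves t := by
  induction t using ind with
  | hl v => exact ⟨v, by simp⟩
  | hn s t hs ht => obtain ⟨v, hv⟩ := hs; exact ⟨v, by simp [hv]⟩

/-- The leaves of the tree are in bijection with `V`: every element of `V` labels exactly one
leaf. -/
def IsBijective (t : CommTree V) : Prop := (leaves t).Nodup ∧ ∀ v, v ∈ leaves t

theorem IsBijective.relabel {t : CommTree V} (ht : t.IsBijective) (σ : V ≃ W) :
    (graft t fun v => leaf (σ v)).IsBijective := by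
  unfold IsBijective
  simp only [leaves_graft, leaves_leaf, Multiset.bind_singleton]
  refine ⟨ht.1.map σ.injective, fun w => ?_⟩
  exact Multiset.mem_map.2 ⟨σ.symm w, ht.2 _, by simp⟩

/-- The labels of the leaves in the partial composition: the leaf `*` is replaced by a tree,
the other ones are kept. -/
def insertAt {A B : Type v} (t : CommTree B) : Option A → CommTree (A ⊕ B)
  | none => graft t fun b => leaf (.inr b)
  | some a => leaf (.inl a)

theorem IsBijective.insert {A B : Type v} {s : CommTree (Option A)} {t : CommTree B}
    (hs : s.IsBijective) (ht : t.IsBijective) : (graft s (insertAt t)).IsBijective := by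
  unfold IsBijective
  rw [leaves_graft]
  constructor
  · rw [Multiset.nodup_bind]
    constructor
    · rintro (_ | a) -
      · simpa [insertAt, leaves_graft, Multiset.bind_singleton] using
          ht.1.map Sum.inr_injective
      · simp [insertAt]
    · refine hs.1.pairwise ?_
      rintro (_ | a) - (_ | a') - h
      · exact absurd rfl h
      · simp [insertAt, leaves_graft, Multiset.bind_singleton, Function.onFun]
      · simp [insertAt, leaves_graft, Multiset.bind_singleton, Function.onFun]
      · simpa [insertAt, Function.onFun, eq_comm] using h
  · rintro (a | b)
    · exact Multiset.mem_bind.2 ⟨some a, hs.2 _, by simp [insertAt]⟩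
    · refine Multiset.mem_bind.2 ⟨none, hs.2 _, ?_⟩
      simpa [insertAt, leaves_graft, Multiset.bind_singleton] using ht.2 b

end CommTree

open CommTree in
/-- The set operad `ComMag`: `ComMag[V]` is the set of nonplanar binary trees with set of leaves
`V`, and the partial composition `s ∘_* t` grafts `t` on the leaf `*` of `s`. -/
def ComMag : SetOperad.{v, v} where
  obj V _ := {t : CommTree V // t.IsBijective}
  map σ t := ⟨graft t.1 fun v => leaf (σ v), t.2.relabel σ⟩
  map_refl t := Subtype.ext (graft_id t.1)
  map_trans σ τ t := Subtype.ext (by simp [graft_graft])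
  positive V _ := ⟨fun t => (exists_mem_leaves t.1).elim fun v _ => isEmptyElim v⟩
  unit V _ := ⟨leaf default, by simp, fun v => by simp [Unique.eq_default v]⟩
  unit_natural σ := Subtype.ext (by simp [Unique.eq_default])
  circ s t := ⟨graft s.1 (insertAt t.1), s.2.insert t.2⟩
  circ_natural σ τ s t := Subtype.ext (by
    simp only [graft_graft]
    congr 1
    ext (_ | a) <;> simp [insertAt, graft_graft])
  circ_parallel s t r := Subtype.ext (by
    simp only [graft_graft]
    congr 1
    ext (_ | _ | a) <;> simp [insertAt, graft_graft, starLeft, starSwap, sumSwapRight])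
  circ_sequential s t r := Subtype.ext (by
    simp only [graft_graft]
    congr 1
    ext (_ | a)
    · simp only [insertAt, graft_graft, graft_leaf]
      congr 1
      ext (_ | a) <;> simp [graft_graft, starRight]
    · simp [insertAt, starRight])
  circ_unit s := Subtype.ext (by
    simp only [graft_graft]
    congr 1
    ext (_ | a) <;> simp [insertAt])
  unit_circ t := Subtype.ext (by
    simp [insertAt, Unique.eq_default]
    rfl)

/-- The generator of `ComMag`: the tree with two leaves `a` and `b`. -/
def ComMag.cherry {V : Type v} [Finite V] (a b : V) (hab : a ≠ b) (hV : ∀ v, v = a ∨ v = b) :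
    ComMag.obj V :=
  ⟨.node (.leaf a) (.leaf b), by simpa using hab, by simpa using hV⟩

/-! ### The graph insertion operad `K G` -/

/-- The positive set species of graphs: `G[V]` is the set of graphs (without loops or multiple
edges) on the vertex set `V`, for `V` non-empty. -/
abbrev graphSpecies : SetSpecies.{v, v} where
  obj V _ := {_g : SimpleGraph V // Nonempty V}
  map σ g := ⟨g.1.comap σ.symm, g.2.map σ⟩
  map_refl _ := rfl
  map_trans _ _ _ := rfl

/-- The graph `(g₁ ∖ {*}) ∪ g₂ ∪ {{v, f v} | v a neighbour of *}` for a map `f` from the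
neighbours of `*` in `g₁` to the vertices of `g₂`. -/
def insertGraph {A B : Type v} (g₁ : SimpleGraph (Option A)) (g₂ : SimpleGraph B)
    (f : {a : A // g₁.Adj none (some a)} → B) : SimpleGraph (A ⊕ B) where
  Adj
    | .inl a, .inl a' => g₁.Adj (some a) (some a')
    | .inr b, .inr b' => g₂.Adj b b'
    | .inl a, .inr b => ∃ h : g₁.Adj none (some a), f ⟨a, h⟩ = b
    | .inr b, .inl a => ∃ h : g₁.Adj none (some a), f ⟨a, h⟩ = b
  symm := ⟨by
    rintro (a | b) (a' | b') h
    · exact SimpleGraph.Adj.symm (G := g₁) h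
    · exact h
    · exact h
    · exact SimpleGraph.Adj.symm (G := g₂) h⟩
  loopless := ⟨by
    rintro (a | b) h
    · exact g₁.irrefl h
    · exact g₂.irrefl h⟩

/-- The insertion of `g₂` into `g₁` at `*`: the sum, over all maps `f` from the neighbours of `*`
in `g₁` to the vertices of `g₂`, of the graphs obtained by reconnecting the edges at `*`
according to `f`. -/
noncomputable def insertion (K : Type u) [Field K] {A B : Type v} [Finite A] [Finite B]
    (g₁ : graphSpecies.obj (Option A)) (g₂ : graphSpecies.obj B) :
    graphSpecies.obj (A ⊕ B) →₀ K :=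
  ∑ᶠ f : {a : A // g₁.1.Adj none (some a)} → B,
    Finsupp.single ⟨insertGraph g₁.1 g₂.1 f, g₂.2.map Sum.inr⟩ 1

/-! Verification of the operad axioms: all graphs occur in an insertion with coefficient `0`
or `1`. -/

/-- `h` occurs in the insertion of `y` into `x`. -/
def Occurs {A B : Type v} (x : SimpleGraph (Option A)) (y : SimpleGraph B)
    (h : SimpleGraph (A ⊕ B)) : Prop :=
  (∀ a a', h.Adj (.inl a) (.inl a') ↔ x.Adj (some a) (some a')) ∧
  (∀ b b', h.Adj (.inr b) (.inr b') ↔ y.Adj b b') ∧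
  (∀ a b, h.Adj (.inl a) (.inr b) → x.Adj none (some a)) ∧
  (∀ a, x.Adj none (some a) → ∃ b, h.Adj (.inl a) (.inr b)) ∧
  (∀ a b b', h.Adj (.inl a) (.inr b) → h.Adj (.inl a) (.inr b') → b = b')

theorem occurs_iff {A B : Type v} (x : SimpleGraph (Option A)) (y : SimpleGraph B)
    (h : SimpleGraph (A ⊕ B)) : Occurs x y h ↔ ∃ f, insertGraph x y f = h := by
  constructor
  · rintro ⟨h1, h2, h3, h4, h5⟩
    choose f hf using h4
    refine ⟨fun a => f a.1 a.2, ?_⟩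
    ext (a | b) (a' | b')
    · exact (h1 a a').symm
    · constructor
      · rintro ⟨h, rfl⟩
        exact hf a h
      · exact fun h => ⟨h3 _ _ h, h5 _ _ _ (hf _ _) h⟩
    · constructor
      · rintro ⟨h, rfl⟩
        exact (hf a' h).symm
      · exact fun h => ⟨h3 _ _ h.symm, h5 _ _ _ (hf _ _) h.symm⟩
    · exact (h2 b b').symm
  · rintro ⟨f, rfl⟩
    refine ⟨fun _ _ => Iff.rfl, fun _ _ => Iff.rfl, fun a b h => h.1, fun a h => ⟨_, h, rfl⟩, ?_⟩
    rintro a b b' ⟨h, rfl⟩ ⟨h', rfl⟩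
    rfl

theorem insertGraph_injective {A B : Type v} (x : SimpleGraph (Option A)) (y : SimpleGraph B) :
    Function.Injective (insertGraph x y) := by
  intro f f' h
  funext a
  have : (insertGraph x y f').Adj (.inl a.1) (.inr (f a)) := h ▸ ⟨a.2, rfl⟩
  exact this.2.symm

theorem Occurs.unique_left {A B : Type v} {x x' : SimpleGraph (Option A)} {y : SimpleGraph B}
    {h : SimpleGraph (A ⊕ B)} (hx : Occurs x y h) (hx' : Occurs x' y h) : x = x' := by
  obtain ⟨h1, -, h3, h4, -⟩ := hx
  obtain ⟨h1', -, h3', h4', -⟩ := hx'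
  have key (a) : x.Adj none (some a) ↔ x'.Adj none (some a) :=
    ⟨fun h => (h4 a h).elim fun b => h3' a b, fun h => (h4' a h).elim fun b => h3 a b⟩
  ext (_ | a) (_ | a')
  · simp
  · exact key a'
  · rw [x.adj_comm, x'.adj_comm]; exact key a
  · rw [← h1, ← h1']

theorem Occurs.unique_right {A B : Type v} {x : SimpleGraph (Option A)} {y y' : SimpleGraph B}
    {h : SimpleGraph (A ⊕ B)} (hx : Occurs x y h) (hx' : Occurs x y' h) : y = y' := by
  ext b b'
  rw [← hx.2.1, ← hx'.2.1]

open Classical in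
/-- The sum of the elements of a set of basis elements. -/
noncomputable def setSum (K : Type u) [Field K] {X : Type*} [Finite X] (s : Set X) : X →₀ K :=
  Finsupp.equivFunOnFinite.symm fun x => if x ∈ s then 1 else 0

open Classical in
theorem setSum_apply {K : Type u} [Field K] {X : Type*} [Finite X] (s : Set X) (x : X) :
    setSum K s x = if x ∈ s then 1 else 0 := rfl

theorem setSum_singleton {K : Type u} [Field K] {X : Type*} [Finite X] (x : X) :
    setSum K {x} = Finsupp.single x 1 := by
  ext y
  classical
  rw [setSum_apply, Finsupp.single_apply]
  exact if_congr eq_comm rfl rfl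

theorem sum_ite_unique {K : Type u} [Field K] {X : Type*} [Fintype X] (p : X → Prop)
    [DecidablePred p] [Decidable (∃ x, p x)]
    (hp : ∀ x y, p x → p y → x = y) :
    (∑ x, if p x then (1 : K) else 0) = if ∃ x, p x then 1 else 0 := by
  by_cases h : ∃ x, p x
  · obtain ⟨x, hx⟩ := h
    rw [if_pos ⟨x, hx⟩, Finset.sum_eq_single x]
    · simp [hx]
    · intro y _ hy
      rw [if_neg fun h => hy (hp _ _ h hx)]
    · simp
  · rw [if_neg h]
    push Not at h
    simp [h]

theorem insertion_eq (K : Type u) [Field K] {A B : Type v} [Finite A] [Finite B]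
    (x : graphSpecies.obj (Option A)) (y : graphSpecies.obj B) :
    insertion K x y = setSum K {h | Occurs x.1 y.1 h.1} := by
  classical
  have := Fintype.ofFinite ({a : A // x.1.Adj none (some a)} → B)
  ext h
  rw [insertion, finsum_eq_sum_of_fintype, Finsupp.finsetSum_apply, setSum_apply]
  simp_rw [Finsupp.single_apply]
  rw [sum_ite_unique]
  · congr 1
    simp only [Set.mem_ofPred_eq, occurs_iff, eq_iff_iff]
    exact exists_congr fun f => Subtype.ext_iff
  · intro f f' hf hf'
    exact insertGraph_injective _ _ (Subtype.ext_iff.1 (hf.trans hf'.symm))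

theorem linMap_setSum {K : Type u} [Field K] {V W : Type v} [Finite V] [Finite W] (σ : V ≃ W)
    (s : Set (graphSpecies.obj V)) :
    graphSpecies.linMap K σ (setSum K s) =
      setSum K {g | graphSpecies.map σ.symm g ∈ s} := by
  classical
  ext g
  have : g = graphSpecies.map σ (graphSpecies.map σ.symm g) := by
    rw [← graphSpecies.map_trans, Equiv.symm_trans_self, graphSpecies.map_refl]
  have hinj : Function.Injective (graphSpecies.map σ) := by
    intro a b hab
    have := congrArg (graphSpecies.map σ.symm) hab
    rwa [← graphSpecies.map_trans, ← graphSpecies.map_trans, Equiv.self_trans_symm,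
      graphSpecies.map_refl, graphSpecies.map_refl] at this
  conv_lhs => rw [this]
  rw [SetSpecies.linMap, Finsupp.lmapDomain_apply, Finsupp.mapDomain_apply hinj,
    setSum_apply, setSum_apply]
  rfl

theorem bilin_setSum_left {K : Type u} [Field K] {A B : Type v} [Finite A] [Finite B]
    (s : Set (graphSpecies.obj (Option A))) (y : graphSpecies.obj B) :
    bilin K (insertion K) (setSum K s) (Finsupp.single y 1) =
      setSum K {h | ∃ k ∈ s, Occurs k.1 y.1 h.1} := by
  classical
  have := Fintype.ofFinite (graphSpecies.obj (Option A))
  ext h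
  rw [bilin, Finsupp.linearCombination_apply, Finsupp.sum_fintype _ _ (by simp)]
  simp only [LinearMap.sum_apply, LinearMap.smul_apply, Finsupp.linearCombination_single, one_smul,
    Finsupp.finsetSum_apply, Finsupp.smul_apply, insertion_eq, setSum_apply, smul_eq_mul,
    mul_ite, mul_one, mul_zero, Set.mem_ofPred_eq, ← ite_and]
  rw [sum_ite_unique]
  · simp only [and_comm]
  · rintro k k' hk hk'
    refine Subtype.ext ?_
    exact hk.1.unique_left hk'.1

theorem bilin_setSum_right {K : Type u} [Field K] {A B : Type v} [Finite A] [Finite B]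
    (x : graphSpecies.obj (Option A)) (s : Set (graphSpecies.obj B)) :
    bilin K (insertion K) (Finsupp.single x 1) (setSum K s) =
      setSum K {h | ∃ k ∈ s, Occurs x.1 k.1 h.1} := by
  classical
  have := Fintype.ofFinite (graphSpecies.obj B)
  ext h
  rw [bilin, Finsupp.linearCombination_single, one_smul, Finsupp.linearCombination_apply,
    Finsupp.sum_fintype _ _ (by simp)]
  simp only [Finsupp.finsetSum_apply, Finsupp.smul_apply, insertion_eq, setSum_apply, smul_eq_mul,
    mul_ite, mul_one, mul_zero, Set.mem_ofPred_eq, ← ite_and]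
  rw [sum_ite_unique]
  · simp only [and_comm]
  · rintro k k' hk hk'
    refine Subtype.ext ?_
    exact hk.1.unique_right hk'.1

/-- The graph on `A ⊔ B` with given restrictions to `A` and `B` and given edges between them. -/
def glue {A B : Type v} (p : SimpleGraph A) (q : SimpleGraph B) (r : A → B → Prop) :
    SimpleGraph (A ⊕ B) where
  Adj
    | .inl a, .inl a' => p.Adj a a'
    | .inr b, .inr b' => q.Adj b b'
    | .inl a, .inr b => r a b
    | .inr b, .inl a => r a b
  symm := ⟨by
    rintro (a | b) (a' | b') h
    · exact SimpleGraph.Adj.symm (G := p) h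
    · exact h
    · exact h
    · exact SimpleGraph.Adj.symm (G := q) h⟩
  loopless := ⟨by
    rintro (a | b) h
    · exact p.irrefl h
    · exact q.irrefl h⟩

theorem occurs_parallel {A B C : Type v} {x : SimpleGraph (Option (Option A))}
    {y : SimpleGraph B} {z : SimpleGraph C} {k : SimpleGraph (Option A ⊕ B)}
    {h : SimpleGraph ((A ⊕ B) ⊕ C)} (hk : Occurs x y k)
    (hh : Occurs (k.comap (starLeft A B).symm) z h) :
    ∃ k', Occurs (x.comap (starSwap A).symm) z k' ∧
      Occurs (k'.comap (starLeft A C).symm) y (h.comap (sumSwapRight A B C)) := by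
  obtain ⟨k1, k2, k3, k4, k5⟩ := hk
  obtain ⟨h1, h2, h3, h4, h5⟩ := hh
  have haa (a a') : h.Adj (.inl (.inl a)) (.inl (.inl a')) ↔
      x.Adj (some (some a)) (some (some a')) := (h1 (.inl a) (.inl a')).trans (k1 _ _)
  have hab (a b) : h.Adj (.inl (.inl a)) (.inl (.inr b)) ↔ k.Adj (.inl (some a)) (.inr b) :=
    h1 (.inl a) (.inr b)
  have hbb (b b') : h.Adj (.inl (.inr b)) (.inl (.inr b')) ↔ y.Adj b b' :=
    (h1 (.inr b) (.inr b')).trans (k2 _ _)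
  have hac3 (a c) (h : h.Adj (.inl (.inl a)) (.inr c)) : x.Adj (some none) (some (some a)) :=
    (k1 _ _).1 (h3 (.inl a) c h)
  have hbc3 (b c) (h : h.Adj (.inl (.inr b)) (.inr c)) : k.Adj (.inl none) (.inr b) :=
    h3 (.inr b) c h
  have hac4 (a) (h : x.Adj (some none) (some (some a))) := h4 (.inl a) ((k1 _ _).2 h)
  have hbc4 (b) (h : k.Adj (.inl none) (.inr b)) := h4 (.inr b) h
  have k3' (b) (h : k.Adj (.inl none) (.inr b)) : x.Adj none (some none) := k3 _ _ h
  refine ⟨glue ((x.comap (starSwap A).symm).comap some) z fun o c =>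
    o.elim (∃ b, h.Adj (.inl (.inr b)) (.inr c)) fun a => h.Adj (.inl (.inl a)) (.inr c),
    ⟨fun _ _ => Iff.rfl, fun _ _ => Iff.rfl, ?_, ?_, ?_⟩, ⟨?_, hbb, ?_, ?_, ?_⟩⟩
  · rintro (_ | a) c hc
    · obtain ⟨b, hb⟩ := hc
      exact (k3' b (hbc3 b c hb)).symm
    · exact hac3 a c hc
  · rintro (_ | a) hx
    · obtain ⟨b, hb⟩ := k4 none (SimpleGraph.Adj.symm (G := x) hx)
      obtain ⟨c, hc⟩ := hbc4 b hb
      exact ⟨c, b, hc⟩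
    · exact hac4 a hx
  · rintro (_ | a) c c' hc hc'
    · obtain ⟨b, hb⟩ := hc
      obtain ⟨b', hb'⟩ := hc'
      obtain rfl := k5 none b b' (hbc3 b c hb) (hbc3 b' c' hb')
      exact h5 _ _ _ hb hb'
    · exact h5 _ _ _ hc hc'
  · rintro (a | c) (a' | c')
    · exact haa a a'
    · exact Iff.rfl
    · exact h.adj_comm _ _
    · exact h2 c c'
  · rintro (a | c) b hb
    · exact k3 _ _ ((hab a b).1 hb)
    · exact ⟨b, SimpleGraph.Adj.symm (G := h) hb⟩
  · rintro (a | c) hx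
    · obtain ⟨b, hb⟩ := k4 (some a) hx
      exact ⟨b, (hab a b).2 hb⟩
    · obtain ⟨b, hb⟩ := hx
      exact ⟨b, SimpleGraph.Adj.symm (G := h) hb⟩
  · rintro (a | c) b b' hb hb'
    · exact k5 _ _ _ ((hab a b).1 hb) ((hab a b').1 hb')
    · exact k5 none b b' (hbc3 b c (SimpleGraph.Adj.symm (G := h) hb))
        (hbc3 b' c (SimpleGraph.Adj.symm (G := h) hb'))

theorem occurs_parallel' {A B C : Type v} {x : SimpleGraph (Option (Option A))}
    {y : SimpleGraph B} {z : SimpleGraph C} {h : SimpleGraph ((A ⊕ B) ⊕ C)}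
    {k : SimpleGraph (Option (A ⊕ B))} (hk : Occurs x y (k.comap (starLeft A B)))
    (hh : Occurs k z h) :
    ∃ k' : SimpleGraph (Option (A ⊕ C)),
      Occurs (x.comap (starSwap A).symm) z (k'.comap (starLeft A C)) ∧
      Occurs k' y (h.comap (sumSwapRight A B C)) := by
  have e : (k.comap (starLeft A B)).comap (starLeft A B).symm = k := by ext; simp
  obtain ⟨k', h1, h2⟩ := occurs_parallel hk (e.symm ▸ hh)
  refine ⟨_, ?_, h2⟩
  have e' : (k'.comap (starLeft A C).symm).comap (starLeft A C) = k' := by ext; simp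
  rwa [e']

theorem occurs_sequential {A B C : Type v} {x : SimpleGraph (Option A)}
    {y : SimpleGraph (Option B)} {z : SimpleGraph C} {h : SimpleGraph (A ⊕ (B ⊕ C))} :
    (∃ k, Occurs x y k ∧ Occurs (k.comap (starRight A B).symm) z
      (h.comap (Equiv.sumAssoc A B C))) ↔ ∃ k, Occurs y z k ∧ Occurs x k h := by
  constructor
  · rintro ⟨k, ⟨k1, k2, k3, k4, k5⟩, h1, h2, h3, h4, h5⟩
    have hab (a b) : h.Adj (.inl a) (.inr (.inl b)) ↔ k.Adj (.inl a) (.inr (some b)) :=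
      h1 (.inl a) (.inr b)
    have hac3 (a c) (h : h.Adj (.inl a) (.inr (.inr c))) : k.Adj (.inl a) (.inr none) :=
      SimpleGraph.Adj.symm (G := k) (h3 (.inl a) c h)
    have hac4 (a) (hk : k.Adj (.inl a) (.inr none)) : ∃ c, h.Adj (.inl a) (.inr (.inr c)) :=
      h4 (.inl a) (SimpleGraph.Adj.symm (G := k) hk)
    refine ⟨h.comap Sum.inr, ⟨?_, h2, ?_, ?_, ?_⟩, ⟨?_, fun _ _ => Iff.rfl, ?_, ?_, ?_⟩⟩
    · exact fun b b' => (h1 (.inr b) (.inr b')).trans (k2 _ _)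
    · exact fun b c hc => (k2 _ _).1 (h3 (.inr b) c hc)
    · exact fun b hb => h4 (.inr b) ((k2 _ _).2 hb)
    · exact fun b c c' hc hc' => h5 (.inr b) c c' hc hc'
    · exact fun a a' => (h1 (.inl a) (.inl a')).trans (k1 _ _)
    · rintro a (b | c) hv
      · exact k3 _ _ ((hab a b).1 hv)
      · exact k3 _ _ (hac3 a c hv)
    · intro a ha
      obtain ⟨_ | b, hb⟩ := k4 a ha
      · obtain ⟨c, hc⟩ := hac4 a hb
        exact ⟨_, hc⟩
      · exact ⟨_, (hab a b).2 hb⟩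
    · rintro a (b | c) (b' | c') hv hv'
      · have := k5 _ _ _ ((hab a b).1 hv) ((hab a b').1 hv')
        simpa using this
      · exact absurd (k5 _ _ _ ((hab a b).1 hv) (hac3 a c' hv')) (by simp)
      · exact absurd (k5 _ _ _ (hac3 a c hv) ((hab a b').1 hv')) (by simp)
      · exact congrArg Sum.inr (h5 (.inl a) c c' hv hv')
  · rintro ⟨k, ⟨k1, k2, k3, k4, k5⟩, h1, h2, h3, h4, h5⟩
    refine ⟨glue (x.comap some) y fun a o =>
      o.elim (∃ c, h.Adj (.inl a) (.inr (.inr c))) fun b => h.Adj (.inl a) (.inr (.inl b)),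
      ⟨fun _ _ => Iff.rfl, fun _ _ => Iff.rfl, ?_, ?_, ?_⟩, ⟨?_, ?_, ?_, ?_, ?_⟩⟩
    · rintro a (_ | b) hv
      · obtain ⟨c, hc⟩ := hv
        exact h3 _ _ hc
      · exact h3 _ _ hv
    · intro a ha
      obtain ⟨b | c, hv⟩ := h4 a ha
      · exact ⟨some b, hv⟩
      · exact ⟨none, c, hv⟩
    · rintro a (_ | b) (_ | b') hv hv'
      · rfl
      · obtain ⟨c, hc⟩ := hv
        exact absurd (h5 _ _ _ hc hv') (by simp)
      · obtain ⟨c, hc⟩ := hv'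
        exact absurd (h5 _ _ _ hv hc) (by simp)
      · have := h5 _ _ _ hv hv'
        simpa using this
    · rintro (a | b) (a' | b')
      · exact h1 a a'
      · exact Iff.rfl
      · exact h.adj_comm _ _
      · exact (h2 _ _).trans (k1 _ _)
    · exact fun c c' => (h2 _ _).trans (k2 _ _)
    · rintro (a | b) c hv
      · exact ⟨c, hv⟩
      · exact k3 _ _ ((h2 _ _).1 hv)
    · rintro (a | b) hv
      · exact hv
      · obtain ⟨c, hc⟩ := k4 _ hv
        exact ⟨c, (h2 _ _).2 hc⟩
    · rintro (a | b) c c' hv hv'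
      · have := h5 _ _ _ hv hv'
        simpa using this
      · exact k5 _ _ _ ((h2 _ _).1 hv) ((h2 _ _).1 hv')

/-- The graph insertion operad `K G`; its unit is given by the one-vertex graphs. -/
noncomputable def graphOperad (K : Type u) [Field K] : LinearOperad.{u, v, max v u} K :=
  LinearOperad.ofBasis K graphSpecies.{v}
    (fun V _ => ⟨fun g => not_isEmpty_iff.2 g.2 inferInstance⟩)
    (fun V _ => ⟨⊥, ⟨default⟩⟩)
    (fun σ => Subtype.ext (by ext; simp))
    (insertion K)
    (fun σ τ x y => by
      rw [insertion_eq, insertion_eq, linMap_setSum]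
      congr 1
      ext h
      obtain ⟨h, _⟩ := h
      obtain ⟨x, _⟩ := x
      obtain ⟨y, _⟩ := y
      have e (o) : (Equiv.optionCongr σ).symm o = o.map σ.symm := rfl
      simp only [Set.mem_ofPred_eq]
      refine and_congr ?_ (and_congr ?_ (and_congr ?_ (and_congr ?_ ?_)))
      · rw [σ.symm.forall_congr_left]
        refine forall_congr' fun a => ?_
        rw [σ.symm.forall_congr_left]
        simp [e]
      · rw [τ.symm.forall_congr_left]
        refine forall_congr' fun a => ?_
        rw [τ.symm.forall_congr_left]
        simp
      · rw [σ.symm.forall_congr_left]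
        refine forall_congr' fun a => ?_
        rw [τ.symm.forall_congr_left]
        simp [e]
      · rw [σ.symm.forall_congr_left]
        refine forall_congr' fun a => ?_
        rw [τ.symm.exists_congr_left]
        simp [e]
      · rw [σ.symm.forall_congr_left]
        refine forall_congr' fun a => ?_
        rw [τ.symm.forall_congr_left]
        refine forall_congr' fun a => ?_
        rw [τ.symm.forall_congr_left]
        simp)
    (fun {A B C} _ _ _ x y z => by
      rw [insertion_eq, insertion_eq, linMap_setSum, linMap_setSum, bilin_setSum_left,
        bilin_setSum_left, linMap_setSum]
      congr 1
      ext h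
      constructor
      · rintro ⟨k, hk, hh⟩
        obtain ⟨k', h1, h2⟩ := occurs_parallel' hk hh
        exact ⟨⟨k', ⟨none⟩⟩, h1, h2⟩
      · rintro ⟨k, hk, hh⟩
        obtain ⟨k', h1, h2⟩ := occurs_parallel' hk hh
        refine ⟨⟨k', ⟨none⟩⟩, ?_, ?_⟩
        · have e : (x.1.comap (starSwap A).symm).comap (starSwap A).symm = x.1 := by
            ext (_ | _ | _) (_ | _ | _) <;> rfl
          rw [← e]
          exact h1
        · have e : (h.1.comap (sumSwapRight A B C)).comap (sumSwapRight A C B) = h.1 := by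
            ext ((_ | _) | _) ((_ | _) | _) <;> rfl
          rw [← e]
          exact h2)
    (fun {A B C} _ _ _ x y z => by
      rw [insertion_eq, insertion_eq, linMap_setSum, bilin_setSum_left,
        bilin_setSum_right, linMap_setSum]
      congr 1
      ext h
      constructor
      · rintro ⟨k, hk, hh⟩
        have e : (k.1.comap (starRight A B)).comap (starRight A B).symm = k.1 := by ext; simp
        obtain ⟨k', h1, h2⟩ := occurs_sequential.1 ⟨_, hk, e.symm ▸ hh⟩
        exact ⟨⟨k', z.2.map Sum.inr⟩, h1, h2⟩
      · rintro ⟨k, hk, hh⟩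
        obtain ⟨k', h1, h2⟩ := occurs_sequential.2 ⟨_, hk, hh⟩
        refine ⟨⟨k'.comap (starRight A B).symm, ⟨none⟩⟩, ?_, h2⟩
        have e : (k'.comap (starRight A B).symm).comap (starRight A B) = k' := by ext; simp
        change Occurs _ _ ((k'.comap (starRight A B).symm).comap (starRight A B))
        rwa [e])
    (fun {A B} _ _ x => by
      rw [insertion_eq, linMap_setSum, ← setSum_singleton]
      congr 1
      ext h
      constructor
      · rintro ⟨h1, h2, h3, h4, h5⟩
        have key (a : A) : h.1.Adj (.inl a) (.inr PUnit.unit) ↔ x.1.Adj none (some a) :=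
          ⟨fun hv => h3 a default hv, fun hx => (h4 a hx).elim fun b hb => hb⟩
        refine Subtype.ext ?_
        ext (a | b) (a' | b')
        · exact h1 a a'
        · exact (key a).trans (x.1.adj_comm _ _)
        · exact (h.1.adj_comm _ _).trans (key a')
        · exact iff_of_false (h.1.irrefl) (x.1.irrefl)
      · rintro rfl
        refine ⟨fun _ _ => Iff.rfl, fun b b' => ?_, fun a b hv => ?_, fun a ha => ?_, ?_⟩
        · exact iff_of_false (x.1.irrefl) (fun hv => hv)
        · exact SimpleGraph.Adj.symm (G := x.1) hv
        · exact ⟨default, SimpleGraph.Adj.symm (G := x.1) ha⟩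
        · exact fun _ _ _ _ _ => Subsingleton.elim _ _)
    (fun {A B} _ _ y => by
      rw [insertion_eq, ← setSum_singleton]
      congr 1
      ext h
      constructor
      · rintro ⟨h1, h2, h3, h4, h5⟩
        refine Subtype.ext ?_
        ext (a | b) (a' | b')
        · exact isEmptyElim a
        · exact isEmptyElim a
        · exact isEmptyElim a'
        · exact h2 b b'
      · rintro rfl
        exact ⟨fun a => isEmptyElim a, fun _ _ => Iff.rfl, fun a => isEmptyElim a,
          fun a => isEmptyElim a, fun a => isEmptyElim a⟩)

/-- The graph on `{a, b}` with a single edge, as a basis element of `K G`. -/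
noncomputable def graphOperad.segment (K : Type u) [Field K] {V : Type v} [Finite V] (a b : V) :
    (graphOperad.{u, v} K).obj V :=
  Finsupp.single (⟨SimpleGraph.edge a b, ⟨a⟩⟩ : graphSpecies.obj V) (1 : K)

/-- The generator of `K ComMag`: the tree with two leaves `a` and `b`. -/
noncomputable def ComMag.generator (K : Type u) [Field K] {V : Type v} [Finite V] (a b : V)
    (hab : a ≠ b) (hV : ∀ v, v = a ∨ v = b) : (ComMag.{v}.linearize K).obj V :=
  Finsupp.single (ComMag.cherry a b hab hV) (1 : K)

end GraphOperad

namespace GraphOperad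

/-! ### Primitive recursion on nonplanar trees -/

namespace CommTree

variable {V : Type v}

/-- Primitive recursion on nonplanar binary trees. -/
def para {M : Type*} (op : CommTree V → M → CommTree V → M → M)
    (comm : ∀ s a t b, op s a t b = op t b s a) (k : V → M) (t : CommTree V) : M :=
  (fold (M := CommTree V × M) (fun x y => (node x.1 y.1, op x.1 x.2 y.1 y.2))
    (fun _ _ => Prod.ext (node_comm _ _) (comm _ _ _ _)) (fun v => (leaf v, k v)) t).2

section para

variable {M : Type*} (op : CommTree V → M → CommTree V → M → M)
    (comm : ∀ s a t b, op s a t b = op t b s a) (k : V → M)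

theorem para_leaf (v : V) : para op comm k (leaf v) = k v := rfl

theorem para_node (s t : CommTree V) :
    para op comm k (node s t) = op s (para op comm k s) t (para op comm k t) := by
  -- The first component of the pair rebuilds the tree, which is what gives `op` access to the
  -- subtrees themselves.
  have h (t : CommTree V) : (fold (M := CommTree V × M)
      (fun x y => (node x.1 y.1, op x.1 x.2 y.1 y.2))
      (fun _ _ => Prod.ext (node_comm _ _) (comm _ _ _ _)) (fun v => (leaf v, k v)) t).1 = t := by
    induction t using ind with
    | hl v => rfl
    | hn s t hs ht => rw [fold_node]; simp only [hs, ht]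
  unfold para
  rw [fold_node]
  simp only [h]

end para

theorem eq_leaf_of_leaves {t : CommTree V} {v : V} (h : leaves t = {v}) : t = leaf v := by
  induction t using ind with
  | hl w => rw [leaves_leaf, Multiset.singleton_inj] at h; rw [h]
  | hn s t _ _ =>
    obtain ⟨a, ha⟩ := exists_mem_leaves s
    obtain ⟨b, hb⟩ := exists_mem_leaves t
    have := congrArg Multiset.card h
    rw [leaves_node, Multiset.card_add, Multiset.card_singleton] at this
    have := Multiset.card_pos_iff_exists_mem.2 ⟨a, ha⟩
    have := Multiset.card_pos_iff_exists_mem.2 ⟨b, hb⟩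
    omega

/-! ### The graphs that occur in the image of a tree -/

/-- There is exactly one edge between the leaves of `s` and those of `t`. -/
def Linked (g : SimpleGraph V) (s t : CommTree V) : Prop :=
  ∃ a ∈ leaves s, ∃ b ∈ leaves t, g.Adj a b ∧
    ∀ a' ∈ leaves s, ∀ b' ∈ leaves t, g.Adj a' b' → a' = a ∧ b' = b

/-- There is no edge between the leaves of `s` and those of `t`. -/
def Unlinked (g : SimpleGraph V) (s t : CommTree V) : Prop :=
  ∀ a ∈ leaves s, ∀ b ∈ leaves t, ¬ g.Adj a b

theorem Linked.symm {g : SimpleGraph V} {s t : CommTree V} (h : Linked g s t) :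
    Linked g t s := by
  obtain ⟨a, ha, b, hb, hab, h⟩ := h
  exact ⟨b, hb, a, ha, hab.symm, fun b' hb' a' ha' h' => (h a' ha' b' hb' h'.symm).symm⟩

theorem linked_comm {g : SimpleGraph V} {s t : CommTree V} : Linked g s t ↔ Linked g t s :=
  ⟨.symm, .symm⟩

theorem unlinked_comm {g : SimpleGraph V} {s t : CommTree V} :
    Unlinked g s t ↔ Unlinked g t s :=
  ⟨fun h b hb a ha hab => h a ha b hb hab.symm, fun h b hb a ha hab => h a ha b hb hab.symm⟩

/-- At every internal node of the tree there is exactly one edge of the graph between the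
leaves of the two subtrees. -/
def Adm (g : SimpleGraph V) : CommTree V → Prop :=
  para (fun s a t b => a ∧ b ∧ Linked g s t)
    (fun s a t b => by rw [linked_comm]; exact propext and_left_comm) fun _ => True

/-- The graph is admitted by the two subtrees at the root of the tree, and it has no edge between
their leaves. -/
def Sep (g : SimpleGraph V) : CommTree V → Prop :=
  para (fun s _ t _ => Adm g s ∧ Adm g t ∧ Unlinked g s t)
    (fun s a t b => by rw [unlinked_comm]; exact propext and_left_comm) fun _ => False

theorem adm_leaf (g : SimpleGraph V) (v : V) : Adm g (leaf v) := trivial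

theorem adm_node {g : SimpleGraph V} {s t : CommTree V} :
    Adm g (node s t) ↔ Adm g s ∧ Adm g t ∧ Linked g s t :=
  iff_of_eq (para_node _ _ _ _ _)

theorem sep_leaf {g : SimpleGraph V} {v : V} : ¬ Sep g (leaf v) := fun h => h

theorem sep_node {g : SimpleGraph V} {s t : CommTree V} :
    Sep g (node s t) ↔ Adm g s ∧ Adm g t ∧ Unlinked g s t :=
  iff_of_eq (para_node _ _ _ _ _)

theorem linked_congr {g g' : SimpleGraph V} {s t : CommTree V}
    (h : ∀ a ∈ leaves s, ∀ b ∈ leaves t, g.Adj a b ↔ g'.Adj a b) :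
    Linked g s t ↔ Linked g' s t := by
  refine exists_congr fun a => and_congr_right fun ha => exists_congr fun b =>
    and_congr_right fun hb => and_congr (h a ha b hb) ?_
  exact forall_congr' fun a => forall_congr' fun ha => forall_congr' fun b =>
    forall_congr' fun hb => imp_congr_left (h a ha b hb)

/-- Admissibility sees only the graph induced on the leaves, so edges elsewhere may be added or
removed freely. -/
theorem adm_congr {g g' : SimpleGraph V} {t : CommTree V}
    (h : ∀ a ∈ leaves t, ∀ b ∈ leaves t, g.Adj a b ↔ g'.Adj a b) : Adm g t ↔ Adm g' t := by
  induction t using ind with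
  | hl v => exact Iff.rfl
  | hn s t hs ht =>
    simp only [leaves_node, Multiset.mem_add] at h
    rw [adm_node, adm_node, hs fun a ha b hb => h a (.inl ha) b (.inl hb),
      ht fun a ha b hb => h a (.inr ha) b (.inr hb),
      linked_congr fun a ha b hb => h a (.inl ha) b (.inr hb)]

/-- The leaves of a tree that admits a graph lie on one side of any partition of the vertices
without edges between the two parts. -/
theorem Adm.mem_iff {g : SimpleGraph V} {t : CommTree V} (ht : Adm g t) {S : Set V}
    (hS : ∀ a b, g.Adj a b → (a ∈ S ↔ b ∈ S)) :
    ∀ a ∈ leaves t, ∀ b ∈ leaves t, (a ∈ S ↔ b ∈ S) := by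
  induction t using ind with
  | hl v => simp +contextual
  | hn s t hs ht' =>
    obtain ⟨h1, h2, c, hc, d, hd, hcd, -⟩ := adm_node.1 ht
    -- The edge `cd` across the node carries the side of `t` over to that of `s`, so `c` can serve
    -- as the reference leaf for both.
    have key : ∀ a ∈ leaves (node s t), (a ∈ S ↔ c ∈ S) := by
      intro a ha
      rw [leaves_node, Multiset.mem_add] at ha
      rcases ha with ha | ha
      · exact hs h1 a ha c hc
      · exact (ht' h2 a ha d hd).trans (hS c d hcd).symm
    exact fun a ha b hb => (key a ha).trans (key b hb).symm

/-! ### Deletion of a leaf -/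

open Classical in
/-- The result of the deletion of the leaf `v`, provided that the sibling of `v` contains the
leaf `u`. -/
noncomputable def del (u v : V) : CommTree V → Option (CommTree V) :=
  para (fun s a t b =>
    if s = leaf v then if u ∈ leaves t then some t else none
    else if t = leaf v then if u ∈ leaves s then some s else none
    else match a, b with
      | some s', none => some (node s' t)
      | none, some t' => some (node s t')
      | _, _ => none)
    (fun s a t b => by
      by_cases hs : s = leaf v
      · by_cases ht : t = leaf v
        · simp [hs, ht]
        · simp [hs, ht]
      · by_cases ht : t = leaf v
        · simp [hs, ht]
        · cases a <;> cases b <;> simp [hs, ht, node_comm])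
    fun _ => none

open Classical in
/-- The sibling of the leaf `v` if it is attached at the root. -/
noncomputable def sibling (v : V) : CommTree V → Option (CommTree V) :=
  para (fun s _ t _ => if s = leaf v then some t else if t = leaf v then some s else none)
    (fun s a t b => by
      by_cases hs : s = leaf v <;> by_cases ht : t = leaf v <;> simp [hs, ht])
    fun _ => none

open Classical in
theorem del_node (u v : V) (s t : CommTree V) : del u v (node s t) =
    if s = leaf v then if u ∈ leaves t then some t else none
    else if t = leaf v then if u ∈ leaves s then some s else none
    else match del u v s, del u v t with
      | some s', none => some (node s' t)
      | none, some t' => some (node s t')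
      | _, _ => none := para_node _ _ _ _ _

open Classical in
theorem sibling_node (v : V) (s t : CommTree V) : sibling v (node s t) =
    if s = leaf v then some t else if t = leaf v then some s else none := para_node _ _ _ _ _

theorem del_eq_none {u v : V} {t : CommTree V} (hv : v ∉ leaves t) : del u v t = none := by
  induction t using ind with
  | hl w => rfl
  | hn s t hs ht =>
    rw [leaves_node, Multiset.mem_add, not_or] at hv
    rw [del_node, if_neg, if_neg, hs hv.1, ht hv.2]
    · rintro rfl; simp at hv
    · rintro rfl; simp at hv

theorem leaves_of_del {u v : V} {t t' : CommTree V} (h : del u v t = some t') :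
    leaves t = v ::ₘ leaves t' ∧ u ∈ leaves t' := by
  induction t using ind generalizing t' with
  | hl w => exact absurd h (by rw [del, para_leaf]; simp)
  | hn s t hs ht =>
    rw [del_node] at h
    split_ifs at h with h1 h2 h3 h4
    · obtain rfl := Option.some.inj h
      exact ⟨by simp [h1], h2⟩
    · obtain rfl := Option.some.inj h
      exact ⟨by simp [h3, add_comm], h4⟩
    · split at h
      · rename_i s' e1 e2
        obtain rfl := Option.some.inj h
        obtain ⟨h5, h6⟩ := hs e1
        simp [h5, h6]
      · rename_i t' e1 e2
        obtain rfl := Option.some.inj h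
        obtain ⟨h5, h6⟩ := ht e2
        simp [h5, h6]
      · simp at h

/-- Deletion of a leaf of the left subtree. -/
theorem del_node_left {u v : V} {s t : CommTree V} (hs : s ≠ leaf v) (ht : v ∉ leaves t) :
    del u v (node s t) = (del u v s).map (node · t) := by
  rw [del_node, if_neg hs, if_neg, del_eq_none ht]
  · cases del u v s <;> rfl
  · rintro rfl; simp at ht

/-! ### Attaching a pendant vertex -/

section edge

variable {g : SimpleGraph V} {u v : V}

theorem sup_edge_adj_left (hg : ∀ a, ¬ g.Adj v a) (huv : u ≠ v) {b : V} :
    (g ⊔ SimpleGraph.edge u v).Adj v b ↔ b = u := by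
  rw [SimpleGraph.sup_adj, SimpleGraph.edge_adj]
  constructor
  · rintro (h | ⟨⟨h, -⟩ | ⟨-, h⟩, -⟩)
    · exact absurd h (hg b)
    · exact absurd h.symm huv
    · exact h
  · rintro rfl
    exact .inr ⟨.inr ⟨rfl, rfl⟩, huv.symm⟩

theorem sup_edge_adj_of_ne {a b : V} (ha : a ≠ v) (hb : b ≠ v) :
    (g ⊔ SimpleGraph.edge u v).Adj a b ↔ g.Adj a b := by
  rw [SimpleGraph.sup_adj, SimpleGraph.edge_adj]
  simp [ha, hb]

theorem adm_sup_edge {t : CommTree V} (hv : v ∉ leaves t) :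
    Adm (g ⊔ SimpleGraph.edge u v) t ↔ Adm g t :=
  adm_congr fun _ ha _ hb => sup_edge_adj_of_ne (by rintro rfl; exact hv ha)
    (by rintro rfl; exact hv hb)

theorem linked_leaf_sup_edge (hg : ∀ a, ¬ g.Adj v a) (huv : u ≠ v) {t : CommTree V} :
    Linked (g ⊔ SimpleGraph.edge u v) (leaf v) t ↔ u ∈ leaves t := by
  constructor
  · rintro ⟨a, ha, b, hb, hab, -⟩
    rw [leaves_leaf, Multiset.mem_singleton] at ha
    subst ha
    rwa [← (sup_edge_adj_left hg huv).1 hab]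
  · intro h
    refine ⟨v, by simp, u, h, (sup_edge_adj_left hg huv).2 rfl, ?_⟩
    simp only [leaves_leaf, Multiset.mem_singleton, forall_eq, true_and]
    exact fun b _ hb => (sup_edge_adj_left hg huv).1 hb

/-- The new edge `uv` lies inside `s`, and `v` has no other neighbour. Across the node, `s` with the
new graph therefore looks like `s'` with the old one. -/
theorem sup_edge_adj_of_cons (hg : ∀ a, ¬ g.Adj v a) (huv : u ≠ v) {s s' t : CommTree V}
    (hs : leaves s = v ::ₘ leaves s') (hus : u ∈ leaves s') (hd : (leaves (node s t)).Nodup)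
    {a b : V} (ha : a ∈ leaves s) (hb : b ∈ leaves t) :
    (g ⊔ SimpleGraph.edge u v).Adj a b ↔ a ∈ leaves s' ∧ g.Adj a b := by
  rw [leaves_node, Multiset.nodup_add, Multiset.disjoint_left] at hd
  obtain ⟨hd1, -, hd⟩ := hd
  rw [hs, Multiset.nodup_cons] at hd1
  have hbv : b ≠ v := by
    rintro rfl
    exact hd (by simp [hs]) hb
  have hbu : b ≠ u := by
    rintro rfl
    exact hd (by simp [hs, hus]) hb
  by_cases hav : a = v
  · subst hav
    rw [sup_edge_adj_left hg huv]
    simp [hbu, hd1.1]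
  · rw [sup_edge_adj_of_ne hav hbv]
    rw [hs, Multiset.mem_cons] at ha
    simp [ha.resolve_left hav]

theorem linked_sup_edge (hg : ∀ a, ¬ g.Adj v a) (huv : u ≠ v) {s s' t : CommTree V}
    (hs : leaves s = v ::ₘ leaves s') (hus : u ∈ leaves s') (hd : (leaves (node s t)).Nodup) :
    Linked (g ⊔ SimpleGraph.edge u v) s t ↔ Linked g s' t := by
  have key {a b} (ha : a ∈ leaves s) (hb : b ∈ leaves t) :=
    sup_edge_adj_of_cons hg huv hs hus hd ha hb
  have hsub {a} (ha : a ∈ leaves s') : a ∈ leaves s := by simp [hs, ha]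
  constructor
  · rintro ⟨a, ha, b, hb, hab, h⟩
    obtain ⟨ha', hab⟩ := (key ha hb).1 hab
    exact ⟨a, ha', b, hb, hab, fun a' ha' b' hb' h' =>
      h a' (hsub ha') b' hb' ((key (hsub ha') hb').2 ⟨ha', h'⟩)⟩
  · rintro ⟨a, ha, b, hb, hab, h⟩
    refine ⟨a, hsub ha, b, hb, (key (hsub ha) hb).2 ⟨ha, hab⟩, fun a' ha' b' hb' h' => ?_⟩
    obtain ⟨h1, h2⟩ := (key ha' hb').1 h'
    exact h a' h1 b' hb' h2

theorem unlinked_sup_edge (hg : ∀ a, ¬ g.Adj v a) (huv : u ≠ v) {s s' t : CommTree V}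
    (hs : leaves s = v ::ₘ leaves s') (hus : u ∈ leaves s') (hd : (leaves (node s t)).Nodup) :
    Unlinked (g ⊔ SimpleGraph.edge u v) s t ↔ Unlinked g s' t := by
  have key {a b} (ha : a ∈ leaves s) (hb : b ∈ leaves t) :=
    sup_edge_adj_of_cons hg huv hs hus hd ha hb
  have hsub {a} (ha : a ∈ leaves s') : a ∈ leaves s := by simp [hs, ha]
  constructor
  · exact fun h a ha b hb hab => h a (hsub ha) b hb ((key (hsub ha) hb).2 ⟨ha, hab⟩)
  · intro h a ha b hb hab
    obtain ⟨h1, h2⟩ := (key ha hb).1 hab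
    exact h a h1 b hb h2

/-- A tree admits a graph with a pendant vertex `v` attached to `u` iff the sibling of the
leaf `v` contains `u` and the tree without `v` admits the graph without `v`. -/
theorem adm_sup_edge_iff (hg : ∀ a, ¬ g.Adj v a) (huv : u ≠ v) {t : CommTree V}
    (ht : (leaves t).Nodup) (hv : v ∈ leaves t) (htv : t ≠ leaf v) :
    Adm (g ⊔ SimpleGraph.edge u v) t ↔ ∃ t', del u v t = some t' ∧ Adm g t' := by
  induction t using ind with
  | hl w =>
    rw [leaves_leaf, Multiset.mem_singleton] at hv
    exact absurd (hv ▸ rfl) htv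
  | hn s t hs ht' =>
    clear htv
    have hv' := hv
    rw [leaves_node, Multiset.mem_add] at hv'
    -- Nodes are commutative, so `v` may be placed in the left subtree.
    wlog hvs : v ∈ leaves s generalizing s t
    · have := this t s ht' hs
      rw [node_comm t s] at this
      exact this ht hv hv'.symm (hv'.resolve_left hvs)
    have hd := ht
    rw [leaves_node, Multiset.nodup_add, Multiset.disjoint_left] at hd
    have hvt := hd.2.2 hvs
    rw [adm_node, adm_sup_edge hvt]
    by_cases hsv : s = leaf v
    · subst hsv
      -- Here `v` hangs directly at this node, and its only edge crosses the node exactly when `u`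
      -- is in the sibling.
      rw [linked_leaf_sup_edge hg huv, del_node, if_pos rfl]
      by_cases hu : u ∈ leaves t <;> simp [hu, adm_leaf]
    · rw [del_node_left hsv hvt, hs hd.1 hvs hsv]
      cases hds : del u v s with
      | none => simp
      | some s' =>
        obtain ⟨h1, h2⟩ := leaves_of_del hds
        rw [linked_sup_edge hg huv h1 h2 ht]
        simp [adm_node]

/-- The two alternatives are distinguished by the position of `v`. If `v` is attached at the root,
the edge `uv` crosses the root, so only the sibling alternative is possible. Otherwise the deletion
takes place inside one root subtree, and the edge `uv` stays there. The sibling alternative is the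
one that does not mention `u`. -/
theorem sep_del_iff (hg : ∀ a, ¬ g.Adj v a) (huv : u ≠ v) {t : CommTree V}
    (ht : (leaves t).Nodup) (hu : u ∈ leaves t) (hv : v ∈ leaves t) :
    ((∃ t', del u v t = some t' ∧ Sep g t') ↔
      (Sep (g ⊔ SimpleGraph.edge u v) t ∨ ∃ t', sibling v t = some t' ∧ Sep g t')) ∧
    ¬ (Sep (g ⊔ SimpleGraph.edge u v) t ∧ ∃ t', sibling v t = some t' ∧ Sep g t') := by
  induction t using ind with
  | hl w =>
    rw [leaves_leaf, Multiset.mem_singleton] at hu hv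
    exact absurd (hu.trans hv.symm) huv
  | hn s t hs ht' =>
    clear hs ht'
    have hv' := hv
    rw [leaves_node, Multiset.mem_add] at hv'
    wlog hvs : v ∈ leaves s generalizing s t
    · have := this t s
      rw [node_comm t s] at this
      exact this ht hu hv hv'.symm (hv'.resolve_left hvs)
    have hd := ht
    rw [leaves_node, Multiset.nodup_add, Multiset.disjoint_left] at hd
    have hvt := hd.2.2 hvs
    rw [sep_node, adm_sup_edge hvt, sibling_node]
    by_cases hsv : s = leaf v
    · subst hsv
      rw [leaves_node, Multiset.mem_add, leaves_leaf, Multiset.mem_singleton] at hu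
      have hut := hu.resolve_left huv
      -- The edge `uv` joins the two root subtrees.
      have : ¬ Unlinked (g ⊔ SimpleGraph.edge u v) (leaf v) t := fun h =>
        h v (by simp) u hut ((sup_edge_adj_left hg huv).2 rfl)
      rw [del_node, if_pos rfl, if_pos hut, if_pos rfl]
      simp [this]
    · have htv : t ≠ leaf v := by
        rintro rfl; simp at hvt
      rw [del_node_left hsv hvt, adm_sup_edge_iff hg huv hd.1 hvs hsv, if_neg hsv, if_neg htv]
      cases hds : del u v s with
      | none => simp
      | some s' =>
        obtain ⟨h1, h2⟩ := leaves_of_del hds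
        rw [unlinked_sup_edge hg huv h1 h2 ht]
        simp [sep_node]

end edge

/-! ### Trees obtained by adding pendant vertices, stars -/

/-- Graph-theoretic trees with a given vertex set, as graphs on the ambient type. -/
inductive TreeOn [DecidableEq V] : Finset V → SimpleGraph V → Prop
  | single (v) : TreeOn {v} ⊥
  | attach {A g u v} : TreeOn A g → u ∈ A → v ∉ A →
      TreeOn (insert v A) (g ⊔ SimpleGraph.edge u v)

theorem TreeOn.mem [DecidableEq V] {A : Finset V} {g : SimpleGraph V} (h : TreeOn A g) {a b : V}
    (hab : g.Adj a b) : a ∈ A ∧ b ∈ A := by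
  induction h with
  | single v => exact absurd hab (by simp)
  | attach h hu hv ih =>
    rw [SimpleGraph.sup_adj, SimpleGraph.edge_adj] at hab
    rcases hab with hab | ⟨⟨rfl, rfl⟩ | ⟨rfl, rfl⟩, -⟩
    · exact ⟨Finset.mem_insert_of_mem (ih hab).1, Finset.mem_insert_of_mem (ih hab).2⟩
    · simp [hu]
    · simp [hu]

theorem TreeOn.nonempty [DecidableEq V] {A : Finset V} {g : SimpleGraph V} (h : TreeOn A g) :
    A.Nonempty := by
  cases h <;> simp

/-- The star with center `c` and branches the elements of `S` other than `c`. -/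
def star (c : V) (S : Finset V) : SimpleGraph V where
  Adj x y := (x = c ∧ y ∈ S ∨ y = c ∧ x ∈ S) ∧ x ≠ y
  symm := ⟨fun _ _ h => ⟨h.1.symm, h.2.symm⟩⟩
  loopless := ⟨fun _ h => h.2 rfl⟩

theorem star_adj {c : V} {S : Finset V} {x y : V} :
    (star c S).Adj x y ↔ (x = c ∧ y ∈ S ∨ y = c ∧ x ∈ S) ∧ x ≠ y := Iff.rfl

theorem star_empty (c : V) : star c ∅ = ⊥ := by
  ext; simp [star_adj]

theorem star_insert [DecidableEq V] (c v : V) (S : Finset V) :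
    star c (insert v S) = star c S ⊔ SimpleGraph.edge c v := by
  ext x y
  simp only [star_adj, SimpleGraph.sup_adj, SimpleGraph.edge_adj, Finset.mem_insert]
  tauto

theorem star_adj_left {c : V} {S : Finset V} (hc : c ∉ S) {y : V} :
    (star c S).Adj c y ↔ y ∈ S := by
  rw [star_adj]
  constructor
  · rintro ⟨⟨-, h⟩ | ⟨rfl, h⟩, h'⟩
    · exact h
    · exact absurd rfl h'
  · intro h
    exact ⟨.inl ⟨rfl, h⟩, by rintro rfl; exact hc h⟩

theorem not_star_adj {c v : V} {S : Finset V} (hvc : v ≠ c) (hv : v ∉ S) (a : V) :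
    ¬ (star c S).Adj v a := by
  rw [star_adj]
  tauto

theorem treeOn_star [DecidableEq V] {c : V} {S : Finset V} (hc : c ∉ S) :
    TreeOn (insert c S) (star c S) := by
  induction S using Finset.induction_on with
  | empty => rw [star_empty]; exact .single c
  | insert v S hv ih =>
    rw [Finset.mem_insert, not_or] at hc
    rw [star_insert, Finset.insert_comm]
    refine .attach (ih hc.2) (Finset.mem_insert_self _ _) ?_
    rw [Finset.mem_insert, not_or]
    exact ⟨fun h => hc.1 h.symm, hv⟩

/-! ### A function on two-component forests that is invariant under moves of pendant vertices -/

section move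

variable [DecidableEq V] {X : Type*} {A : Finset V} {N : SimpleGraph V → X}

/-- The function `N` does not change when a pendant vertex is moved. -/
def MoveInvariant (A : Finset V) (N : SimpleGraph V → X) : Prop :=
  ∀ (h : SimpleGraph V) (v u u' : V), v ∈ A → u ∈ A → u' ∈ A → u ≠ v → u' ≠ v →
    (∀ a, ¬ h.Adj v a) → N (h ⊔ SimpleGraph.edge u v) = N (h ⊔ SimpleGraph.edge u' v)

/-- The pendant vertices of the tree on `B` are moved one by one to a vertex of `C`, until a single
vertex of `B` remains. -/
theorem MoveInvariant.exists_isolated (hN : MoveInvariant A N) {B C : Finset V}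
    {g h : SimpleGraph V} (hB : TreeOn B g) (hC : TreeOn C h) (hBC : Disjoint B C)
    (hA : B ∪ C = A) : ∃ b ∈ A, ∃ h', TreeOn (A.erase b) h' ∧ N (g ⊔ h) = N h' := by
  induction hB generalizing C h with
  | single b =>
    refine ⟨b, by simp [← hA], h, ?_, by rw [bot_sup_eq]⟩
    rw [Finset.disjoint_singleton_left] at hBC
    rwa [← hA, Finset.singleton_union, Finset.erase_insert hBC]
  | @attach B g u v hB hu hv ih =>
    obtain ⟨c, hc⟩ := hC.nonempty
    rw [Finset.disjoint_insert_left] at hBC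
    obtain ⟨b, hb, h', h1, h2⟩ := ih (hC.attach hc hBC.1)
      (Finset.disjoint_insert_right.2 ⟨hv, hBC.2⟩) (by
        rw [← hA, Finset.union_insert, Finset.insert_union])
    refine ⟨b, hb, h', h1, ?_⟩
    -- Both forests become a common graph, in which `v` is isolated, plus one edge at `v`: to `u` in
    -- `B` or to `c` in `C`.
    rw [← h2, sup_right_comm, ← sup_assoc]
    refine hN _ v u c (by simp [← hA]) (by simp [← hA, hu]) (by simp [← hA, hc])
      (by rintro rfl; exact hv hu) (by rintro rfl; exact hBC.1 hc) ?_
    rintro a (h | h)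
    · exact hv (hB.mem h).1
    · exact hBC.1 (hC.mem h).1

/-- The pendant vertices of the tree on `C` are moved one by one to `b`. The set `S` collects those
already moved, and the last vertex of `C` stays isolated. -/
theorem MoveInvariant.exists_star (hN : MoveInvariant A N) {b : V} {S C : Finset V}
    {h : SimpleGraph V} (hC : TreeOn C h) (hbS : b ∉ S) (hbC : b ∉ C) (hSC : Disjoint S C)
    (hA : insert b (S ∪ C) = A) :
    ∃ c ∈ A, c ≠ b ∧ N (star b S ⊔ h) = N (star b ((A.erase b).erase c)) := by
  induction hC generalizing S with
  | single c =>
    rw [Finset.disjoint_singleton_right] at hSC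
    refine ⟨c, by simp [← hA], by rintro rfl; simp at hbC, ?_⟩
    have : (A.erase b).erase c = S := by
      ext x
      simp only [← hA, Finset.mem_erase, Finset.mem_insert, Finset.mem_union,
        Finset.mem_singleton]
      constructor
      · tauto
      · exact fun hx => ⟨by rintro rfl; exact hSC hx, by rintro rfl; exact hbS hx, by tauto⟩
    rw [this, sup_bot_eq]
  | @attach C h u v hC hu hv ih =>
    rw [Finset.disjoint_insert_right] at hSC
    rw [Finset.mem_insert, not_or] at hbC
    obtain ⟨c, hc, hcb, h1⟩ := ih (S := insert v S) (by simp [hbC.1, hbS]) hbC.2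
      (Finset.disjoint_insert_left.2 ⟨hv, hSC.2⟩) (by
        rw [← hA, Finset.union_insert, Finset.insert_union])
    refine ⟨c, hc, hcb, ?_⟩
    rw [← h1, ← sup_assoc, star_insert, sup_right_comm (star b S) (SimpleGraph.edge b v)]
    refine hN _ v u b (by simp [← hA]) (by simp [← hA, hu]) (by simp [← hA])
      (by rintro rfl; exact hv hu) hbC.1 ?_
    rintro a (h | h)
    · exact not_star_adj (fun h => hbC.1 h.symm) hSC.1 a h
    · exact hv (hC.mem h).1

/-- Each branch in `S` is a pendant vertex, which moves from the center `c` to the center `b`. -/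
theorem MoveInvariant.star_comm (hN : MoveInvariant A N) {b c : V} (hb : b ∈ A) (hc : c ∈ A)
    {S T : Finset V} (hST : Disjoint S T)
    (hS : S ⊆ (A.erase b).erase c)
    (hT : T ⊆ (A.erase b).erase c) : N (star c S ⊔ star b T) = N (star b (T ∪ S)) := by
  induction S using Finset.induction_on generalizing T with
  | empty => rw [star_empty, bot_sup_eq, Finset.union_empty]
  | insert v S hv ih =>
    rw [Finset.disjoint_insert_left] at hST
    rw [Finset.insert_subset_iff] at hS
    obtain ⟨hvc, hvb, hvA⟩ := (by simpa using hS.1 : v ≠ c ∧ v ≠ b ∧ v ∈ A)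
    rw [Finset.union_insert, ← Finset.insert_union,
      ← ih (Finset.disjoint_insert_right.2 ⟨hv, hST.2⟩) hS.2
        (Finset.insert_subset_iff.2 ⟨hS.1, hT⟩), star_insert, star_insert,
      sup_right_comm, ← sup_assoc]
    refine hN _ v c b hvA hc hb hvc.symm hvb.symm ?_
    rintro a (h | h)
    · exact not_star_adj hvc hv a h
    · exact not_star_adj hvb hST.1 a h

theorem MoveInvariant.star_swap (hN : MoveInvariant A N) {b c : V} (hb : b ∈ A) (hc : c ∈ A) :
    N (star c ((A.erase c).erase b)) = N (star b ((A.erase b).erase c)) := by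
  rw [Finset.erase_right_comm]
  have := hN.star_comm hb hc (Finset.disjoint_empty_right _) (Finset.Subset.refl _)
    (Finset.empty_subset _)
  rwa [star_empty, sup_bot_eq, Finset.empty_union] at this

/-- With `b` isolated, move the branch `b'` from `c` to `b`. The edge between `b` and `b'` can
equally be read as `b` pendant at `b'`; moving `b` to `c` then leaves `b'` isolated. -/
theorem MoveInvariant.star_change (hN : MoveInvariant A N) {b b' c : V} (hb : b ∈ A)
    (hb' : b' ∈ A) (hc : c ∈ A) (hbc : b ≠ c) (hbc' : b' ≠ c) :
    N (star c ((A.erase c).erase b)) = N (star c ((A.erase c).erase b')) := by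
  by_cases hbb : b = b'
  · rw [hbb]
  have e1 : (A.erase c).erase b = insert b' (((A.erase c).erase b).erase b') := by
    rw [Finset.insert_erase]
    simp [hb', hbc', Ne.symm hbb]
  have e2 : (A.erase c).erase b' = insert b (((A.erase c).erase b).erase b') := by
    rw [Finset.erase_right_comm (s := A.erase c), Finset.insert_erase]
    simp [hb, hbc, hbb]
  rw [e1, e2, star_insert, star_insert,
    hN _ b' c b hb' hc hb hbc'.symm hbb (not_star_adj hbc' (by simp)),
    SimpleGraph.edge_comm,
    hN _ b b' c hb hb' hc (Ne.symm hbb) hbc.symm (not_star_adj hbc (by simp))]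

/-- When the centers differ, first change the isolated vertex to the new center, exchange the two,
and then change the isolated vertex again. -/
theorem MoveInvariant.star_eq (hN : MoveInvariant A N) {b c b' c' : V} (hb : b ∈ A)
    (hb' : b' ∈ A) (hc : c ∈ A) (hc' : c' ∈ A) (hbc : b ≠ c) (hbc' : b' ≠ c') :
    N (star c ((A.erase c).erase b)) = N (star c' ((A.erase c').erase b')) := by
  by_cases h : c = c'
  · subst h
    exact hN.star_change hb hb' hc hbc hbc'
  · rw [hN.star_change hb hc' hc hbc (Ne.symm h), hN.star_swap hc' hc,
      hN.star_change hc hb' hc' h hbc']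

/-- A function on two-component forests that is invariant under moves of pendant vertices
is constant. -/
theorem MoveInvariant.eq_star (hN : MoveInvariant A N) {B C : Finset V}
    {g h : SimpleGraph V} (hB : TreeOn B g) (hC : TreeOn C h) (hBC : Disjoint B C)
    (hA : B ∪ C = A) {b c : V} (hb : b ∈ A) (hc : c ∈ A) (hbc : b ≠ c) :
    N (g ⊔ h) = N (star c ((A.erase c).erase b)) := by
  obtain ⟨b', hb', h', h1, h2⟩ := hN.exists_isolated hB hC hBC hA
  obtain ⟨c', hc', hcb', h3⟩ := hN.exists_star (S := ∅) h1 (Finset.notMem_empty _)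
    (Finset.notMem_erase _ _) (Finset.disjoint_empty_left _)
    (by rw [Finset.empty_union, Finset.insert_erase hb'])
  rw [star_empty, bot_sup_eq] at h3
  rw [h2, h3]
  exact hN.star_eq hc' hb hb' hc hcb' hbc

end move

/-! ### Linear independence -/

section linear

variable (K : Type u) [Field K]

open Classical in
/-- The sum of the coefficients of the trees with a given property. -/
noncomputable def ev (p : CommTree V → Prop) : (CommTree V →₀ K) →ₗ[K] K :=
  Finsupp.linearCombination K fun t => if p t then 1 else 0

/-- The linear extension of a partially defined map. -/
noncomputable def linPartial {X Y : Type*} (f : X → Option Y) : (X →₀ K) →ₗ[K] (Y →₀ K) :=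
  Finsupp.linearCombination K fun x => (f x).elim 0 fun y => Finsupp.single y 1

/-- The formal linear combinations of trees with set of leaves `A`. -/
def SupportedOn (A : Finset V) (c : CommTree V →₀ K) : Prop :=
  ∀ t ∈ c.support, leaves t = A.val

variable {K}

open Classical in
theorem ev_apply (p : CommTree V → Prop) (c : CommTree V →₀ K) :
    ev K p c = ∑ t ∈ c.support, if p t then c t else 0 := by
  rw [ev, Finsupp.linearCombination_apply, Finsupp.sum]
  simp

theorem ev_congr {p q : CommTree V → Prop} {c : CommTree V →₀ K}
    (h : ∀ t ∈ c.support, (p t ↔ q t)) : ev K p c = ev K q c := by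
  classical
  rw [ev_apply, ev_apply]
  exact Finset.sum_congr rfl fun t ht => if_congr (h t ht) rfl rfl

theorem ev_or {p q r : CommTree V → Prop} {c : CommTree V →₀ K}
    (h : ∀ t ∈ c.support, (p t ↔ (q t ∨ r t)) ∧ ¬ (q t ∧ r t)) :
    ev K p c = ev K q c + ev K r c := by
  classical
  simp only [ev_apply, ← Finset.sum_add_distrib]
  refine Finset.sum_congr rfl fun t ht => ?_
  obtain ⟨h1, h2⟩ := h t ht
  by_cases hq : q t <;> by_cases hr : r t <;> simp_all

/-- This turns tests of a combination obtained by deletion or contraction into tests of the original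
one, which is how the induction hypothesis is applied. -/
theorem ev_linPartial (p : CommTree V → Prop) (f : CommTree V → Option (CommTree V))
    (c : CommTree V →₀ K) :
    ev K p (linPartial K f c) = ev K (fun t => ∃ t', f t = some t' ∧ p t') c := by
  classical
  induction c using Finsupp.induction_linear with
  | zero => simp
  | add x y hx hy => rw [map_add, map_add, map_add, hx, hy]
  | single t r =>
    rw [linPartial, Finsupp.linearCombination_single, map_smul, ev, ev,
      Finsupp.linearCombination_single]
    cases f t <;> simp

theorem supportedOn_linPartial {A : Finset V} {f : CommTree V → Option (CommTree V)}
    {c : CommTree V →₀ K} (h : ∀ t ∈ c.support, ∀ t', f t = some t' → leaves t' = A.val) :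
    SupportedOn K A (linPartial K f c) := by
  classical
  intro t' ht'
  rw [linPartial, Finsupp.linearCombination_apply] at ht'
  obtain ⟨t, ht, ht'⟩ := Finset.mem_biUnion.1 (Finsupp.support_finsetSum ht')
  have := Finsupp.support_smul ht'
  refine h t ht t' ?_
  cases hf : f t with
  | none => simp [hf] at this
  | some s =>
    rw [hf] at this
    have := Finsupp.support_single_subset this
    rw [Finset.mem_singleton.1 this]

theorem linPartial_apply (f : CommTree V → Option (CommTree V)) (c : CommTree V →₀ K)
    (s : CommTree V) : linPartial K f c s = ev K (fun t => f t = some s) c := by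
  classical
  induction c using Finsupp.induction_linear with
  | zero => simp
  | add x y hx hy => rw [map_add, map_add, Finsupp.add_apply, hx, hy]
  | single t r =>
    rw [linPartial, ev, Finsupp.linearCombination_single, Finsupp.linearCombination_single]
    cases f t <;> simp [Finsupp.single_apply]

theorem ev_eq (c : CommTree V →₀ K) (s : CommTree V) : ev K (fun t => t = s) c = c s := by
  classical
  rw [ev_apply]
  simp +contextual

theorem SupportedOn.nodup {A : Finset V} {c : CommTree V →₀ K} (hc : SupportedOn K A c)
    {t : CommTree V} (ht : t ∈ c.support) : (leaves t).Nodup := hc t ht ▸ A.nodup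

theorem SupportedOn.mem {A : Finset V} {c : CommTree V →₀ K} (hc : SupportedOn K A c)
    {t : CommTree V} (ht : t ∈ c.support) {v : V} : v ∈ leaves t ↔ v ∈ A := by
  rw [hc t ht, Finset.mem_val]

variable [DecidableEq V]

variable (K) in
/-- The combinations of trees with set of leaves `A` are determined by the sums of their
coefficients over the trees that admit a given graph on `A`. -/
def Separated (A : Finset V) : Prop :=
  ∀ c : CommTree V →₀ K, SupportedOn K A c → (∀ g, TreeOn A g → ev K (Adm g) c = 0) → c = 0

/-- A tree graph on `A.erase v` becomes one on `A` when `v` is attached to `u`. By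
`adm_sup_edge_iff`, the tests of the deleted combination are thus among the tests of `c` known to
vanish. -/
theorem linPartial_del_eq_zero {A : Finset V} {c : CommTree V →₀ K} (hc : SupportedOn K A c)
    (h : ∀ g, TreeOn A g → ev K (Adm g) c = 0) {u v : V} (hu : u ∈ A) (hv : v ∈ A) (huv : u ≠ v)
    (hA : Separated K (A.erase v)) : linPartial K (del u v) c = 0 := by
  refine hA _ (supportedOn_linPartial fun t ht t' ht' => ?_) fun g hg => ?_
  · rw [Finset.erase_val, ← hc t ht, (leaves_of_del ht').1, Multiset.erase_cons_head]
  · have hv' := Finset.notMem_erase v A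
    have hg' := hg.attach (Finset.mem_erase.2 ⟨huv, hu⟩) hv'
    rw [Finset.insert_erase hv] at hg'
    rw [ev_linPartial, ← h _ hg']
    refine ev_congr fun t ht => ?_
    refine (adm_sup_edge_iff (fun a ha => hv' (hg.mem ha).1) huv (hc.nodup ht)
      -- The remaining goal is that `t` is not the single leaf `v`, a tree that admits every graph
      -- but has no deletion; `u` is a second leaf.
      ((hc.mem ht).2 hv) ?_).symm
    rintro rfl
    have := (hc.mem ht).2 hu
    simp [huv] at this

/-- In `key`, the deleted combination is zero, so the two exclusive alternatives of `sep_del_iff`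
have opposite sums. The right-hand side does not involve `u`. -/
theorem moveInvariant {A : Finset V} {c : CommTree V →₀ K} (hc : SupportedOn K A c)
    (h : ∀ g, TreeOn A g → ev K (Adm g) c = 0) (hA : ∀ v ∈ A, Separated K (A.erase v)) :
    MoveInvariant A fun h => ev K (Sep h) c := by
  have key (g : SimpleGraph V) (v u : V) (hv : v ∈ A) (hu : u ∈ A) (huv : u ≠ v)
      (hg : ∀ a, ¬ g.Adj v a) : ev K (Sep (g ⊔ SimpleGraph.edge u v)) c =
        - ev K (fun t => ∃ t', sibling v t = some t' ∧ Sep g t') c := by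
    rw [eq_neg_iff_add_eq_zero, ← ev_or (p := fun t => ∃ t', del u v t = some t' ∧ Sep g t'),
      ← ev_linPartial, linPartial_del_eq_zero hc h hu hv huv (hA v hv), map_zero]
    exact fun t ht => sep_del_iff hg huv (hc.nodup ht) ((hc.mem ht).2 hu) ((hc.mem ht).2 hv)
  intro g v u u' hv hu hu' huv huv' hg
  exact (key g v u hv hu huv hg).trans (key g v u' hv hu' huv' hg).symm

/-- The edge of a star that joins the two subtrees at the root of a tree admitting the star. -/
theorem exists_sep_star_iff {t : CommTree V} {A : Finset V} (ht : leaves t = A.val) {c : V}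
    (hc : c ∈ A) (hA : t ≠ leaf c) : ∃ w ∈ A.erase c, ∀ w' ∈ A.erase c,
      (Sep (star c ((A.erase c).erase w')) t ↔ w' = w ∧ Adm (star c (A.erase c)) t) := by
  induction t using ind with
  | hl v =>
    rw [← Finset.mem_val, ← ht, leaves_leaf, Multiset.mem_singleton] at hc
    exact absurd (hc ▸ rfl) hA
  | hn s t hs ht' =>
    clear hs ht' hA
    have hc' := hc
    rw [← Finset.mem_val, ← ht, leaves_node, Multiset.mem_add] at hc'
    wlog hcs : c ∈ leaves s generalizing s t
    · have := this t s
      rw [node_comm t s] at this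
      exact this ht hc'.symm (hc'.resolve_left hcs)
    have hd : (leaves (node s t)).Nodup := ht ▸ A.nodup
    rw [leaves_node, Multiset.nodup_add, Multiset.disjoint_left] at hd
    obtain ⟨-, -, hd⟩ := hd
    have hm (x) : x ∈ A ↔ x ∈ leaves s ∨ x ∈ leaves t := by
      rw [← Finset.mem_val, ← ht, leaves_node, Multiset.mem_add]
    -- Any leaf of the side without the center will do: the center is adjacent to all of them, so if
    -- there is more than one, both sides of the equivalence fail.
    obtain ⟨w, hw⟩ := exists_mem_leaves t
    have hct := hd hcs
    have hws : w ∉ leaves s := fun h => hd h hw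
    have hwc : w ≠ c := by rintro rfl; exact hct hw
    have hwA : w ∈ A.erase c := Finset.mem_erase.2 ⟨hwc, (hm w).2 (.inr hw)⟩
    refine ⟨w, hwA, fun w' hw' => ?_⟩
    have hne {w'} : c ∉ (A.erase c).erase w' := by simp
    by_cases hww : w' = w
    · subst hww
      rw [sep_node, adm_node, and_iff_right rfl]
      -- Removing the branch `w'` changes nothing inside the subtrees, since `w'` and the center lie
      -- on opposite sides. Only the condition across the root is affected.
      refine and_congr (adm_congr ?_) (and_congr (adm_congr ?_) ⟨?_, ?_⟩)
      · intro a ha b hb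
        have : a ≠ w' := by rintro rfl; exact hws ha
        have : b ≠ w' := by rintro rfl; exact hws hb
        simp [star_adj, *]
      · intro a ha b hb
        have : a ≠ c := by rintro rfl; exact hct ha
        have : b ≠ c := by rintro rfl; exact hct hb
        simp [star_adj, *]
      · intro h
        refine ⟨c, hcs, w', hw, (star_adj_left (Finset.notMem_erase _ _)).2 hwA, ?_⟩
        intro a ha b hb hab
        have hbc : b ≠ c := by rintro rfl; exact hct hb
        obtain ⟨⟨rfl, h2⟩ | ⟨h1, -⟩, -⟩ := hab
        · refine ⟨rfl, ?_⟩
          by_contra hbw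
          exact h a ha b hb ((star_adj_left hne).2 (Finset.mem_erase.2 ⟨hbw, h2⟩))
        · exact absurd h1 hbc
      · rintro ⟨a, ha, b, hb, hab, h⟩ a' ha' b' hb' hab'
        obtain ⟨rfl, rfl⟩ := h c hcs w' hw ((star_adj_left (Finset.notMem_erase _ _)).2 hwA)
        have h' : (star c (A.erase c)).Adj a' b' := by
          rw [star_adj] at hab' ⊢
          simp only [Finset.mem_erase] at hab' ⊢
          tauto
        obtain ⟨rfl, rfl⟩ := h a' ha' b' hb' h'
        rw [star_adj_left hne] at hab'
        simp at hab'
    -- If another branch is removed, the edge from the center to `w` remains and crosses the root.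
    · simp only [hww, false_and, iff_false, sep_node]
      rintro ⟨-, -, h⟩
      exact h c hcs w hw ((star_adj_left hne).2 (Finset.mem_erase.2 ⟨Ne.symm hww, hwA⟩))

/-- Each tree admitting the star is counted once on the right, for the branch `w` whose edge crosses
its root; the other trees are never counted. -/
theorem ev_adm_star {A : Finset V} {c : CommTree V →₀ K} (hc : SupportedOn K A c) {v : V}
    (hv : v ∈ A) (hA : (A.erase v).Nonempty) : ev K (Adm (star v (A.erase v))) c =
      ∑ w ∈ A.erase v, ev K (Sep (star v ((A.erase v).erase w))) c := by
  classical
  simp only [ev_apply]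
  rw [Finset.sum_comm]
  refine Finset.sum_congr rfl fun t ht => ?_
  obtain ⟨u, hu⟩ := hA
  obtain ⟨w, hw, h⟩ := exists_sep_star_iff (hc t ht) hv (by
    rintro rfl
    have := (hc.mem ht).2 (Finset.mem_of_mem_erase hu)
    simp [Finset.ne_of_mem_erase hu] at this)
  rw [Finset.sum_eq_single w]
  · simp [h w hw]
  · intro w' hw' hne
    simp [h w' hw', hne]
  · exact fun h => absurd hw h

/-- The sums of coefficients vanish for two-component forests as well. -/
theorem ev_sep_eq_zero [CharZero K] {A : Finset V} {c : CommTree V →₀ K}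
    (hc : SupportedOn K A c) (h : ∀ g, TreeOn A g → ev K (Adm g) c = 0)
    (hA : ∀ v ∈ A, Separated K (A.erase v)) {B C : Finset V}
    {g₁ g₂ : SimpleGraph V} (hB : TreeOn B g₁) (hC : TreeOn C g₂) (hBC : Disjoint B C)
    (hBCA : B ∪ C = A) : ev K (Sep (g₁ ⊔ g₂)) c = 0 := by
  have hN := moveInvariant hc h hA
  obtain ⟨b, hb⟩ := hB.nonempty
  obtain ⟨v, hv⟩ := hC.nonempty
  have hbv : b ≠ v := by
    rintro rfl
    exact Finset.disjoint_left.1 hBC hb hv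
  replace hb : b ∈ A := by simp [← hBCA, hb]
  replace hv : v ∈ A := by simp [← hBCA, hv]
  have hne : (A.erase v).Nonempty := ⟨b, Finset.mem_erase.2 ⟨hbv, hb⟩⟩
  have hs := ev_adm_star hc hv hne
  have hstar := treeOn_star (Finset.notMem_erase v A)
  rw [Finset.insert_erase hv] at hstar
  -- All summands equal the value at `g₁ ⊔ g₂`, so the identity says that a positive integer times
  -- this value is zero. This is where characteristic zero enters.
  rw [h _ hstar, Finset.sum_congr rfl (g := fun _ => ev K (Sep (g₁ ⊔ g₂)) c), Finset.sum_const,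
    nsmul_eq_mul, eq_comm, mul_eq_zero, Nat.cast_eq_zero, Finset.card_eq_zero] at hs
  · exact hs.resolve_left hne.ne_empty
  · intro w hw
    exact (hN.eq_star hB hC hBC hBCA (Finset.mem_of_mem_erase hw) hv
      (Finset.ne_of_mem_erase hw)).symm

/-! ### Splitting at the root -/

/-- The pair of subtrees at the root, if their sets of leaves are `B` and `C`. -/
noncomputable def split (B C : Finset V) (h : B ≠ C) :
    CommTree V → Option (CommTree V × CommTree V) :=
  para (fun s _ t _ =>
    if leaves s = B.val ∧ leaves t = C.val then some (s, t)
    else if leaves t = B.val ∧ leaves s = C.val then some (t, s) else none)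
    (fun s a t b => by
      by_cases h1 : leaves s = B.val ∧ leaves t = C.val
      · rw [if_pos h1, if_neg, if_pos h1]
        -- Both orders of the subtrees fit only if `B = C`. Excluding this makes the ordered pair
        -- well defined on nonplanar trees.
        exact fun h2 => h (Finset.val_injective (h1.1.symm.trans h2.2))
      · rw [if_neg h1]
        by_cases h2 : leaves t = B.val ∧ leaves s = C.val
        · rw [if_pos h2, if_pos h2]
        · rw [if_neg h2, if_neg h2, if_neg h1])
    fun _ => none

theorem split_node {B C : Finset V} (h : B ≠ C) (s t : CommTree V) : split B C h (node s t) =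
    if leaves s = B.val ∧ leaves t = C.val then some (s, t)
    else if leaves t = B.val ∧ leaves s = C.val then some (t, s) else none :=
  para_node _ _ _ _ _

theorem split_eq_some_iff {B C : Finset V} (h : B ≠ C) {t p q : CommTree V} :
    split B C h t = some (p, q) ↔ t = node p q ∧ leaves p = B.val ∧ leaves q = C.val := by
  constructor
  · intro ht
    induction t using ind with
    | hl v => exact absurd ht (by rw [split, para_leaf]; simp)
    | hn s t _ _ =>
      rw [split_node] at ht
      split_ifs at ht with h1 h2
      · obtain ⟨rfl, rfl⟩ := Prod.ext_iff.1 (Option.some.inj ht)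
        exact ⟨rfl, h1⟩
      · obtain ⟨rfl, rfl⟩ := Prod.ext_iff.1 (Option.some.inj ht)
        exact ⟨node_comm _ _, h2⟩
  · rintro ⟨rfl, hp⟩
    rw [split_node, if_pos hp]

/-- A subtree that admits the forest has its leaves in one component (`Adm.mem_iff`). The two root
subtrees together cover both components, so their leaf sets are exactly `B` and `C`. -/
theorem sep_sup_iff {B C : Finset V} {g₁ g₂ : SimpleGraph V} (hB : TreeOn B g₁)
    (hC : TreeOn C g₂) (hBC : Disjoint B C) (h : B ≠ C) {t : CommTree V}
    (ht : leaves t = (B ∪ C).val) :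
    Sep (g₁ ⊔ g₂) t ↔ ∃ p q, split B C h t = some (p, q) ∧ Adm g₁ p ∧ Adm g₂ q := by
  have hcongr₁ {p} (hp : leaves p = B.val) : Adm (g₁ ⊔ g₂) p ↔ Adm g₁ p := by
    refine adm_congr fun a ha b hb => ?_
    rw [hp] at ha
    exact or_iff_left fun h => Finset.disjoint_left.1 hBC ha (hC.mem h).1
  have hcongr₂ {p} (hp : leaves p = C.val) : Adm (g₁ ⊔ g₂) p ↔ Adm g₂ p := by
    refine adm_congr fun a ha b hb => ?_
    rw [hp] at ha
    exact or_iff_right fun h => Finset.disjoint_left.1 hBC (hB.mem h).1 ha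
  have hedge (a b) (hab : (g₁ ⊔ g₂).Adj a b) : a ∈ (B : Set V) ↔ b ∈ (B : Set V) := by
    rcases hab with hab | hab
    · exact iff_of_true (hB.mem hab).1 (hB.mem hab).2
    · exact iff_of_false (fun h => Finset.disjoint_left.1 hBC h (hC.mem hab).1)
        (fun h => Finset.disjoint_left.1 hBC h (hC.mem hab).2)
  constructor
  · induction t using ind with
    | hl v => exact fun h => absurd h sep_leaf
    | hn s t hs ht' =>
      clear hs ht'
      intro hsep
      have hd : (leaves (node s t)).Nodup := ht ▸ (B ∪ C).nodup
      rw [leaves_node, Multiset.nodup_add, Multiset.disjoint_left] at hd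
      have hm (x) : x ∈ leaves s ∨ x ∈ leaves t ↔ x ∈ B ∨ x ∈ C := by
        rw [← Finset.mem_union, ← Finset.mem_val, ← ht, leaves_node, Multiset.mem_add]
      obtain ⟨b, hb⟩ := hB.nonempty
      wlog hbs : b ∈ leaves s generalizing s t
      · have := this t s
        rw [node_comm t s] at this
        exact this ht hsep ⟨hd.2.1, hd.1, fun h1 h2 => hd.2.2 h2 h1⟩
          (fun x => or_comm.trans (hm x)) (((hm b).2 (.inl hb)).resolve_left hbs)
      obtain ⟨h1, h2, -⟩ := sep_node.1 hsep
      have hsB (x) (hx : x ∈ leaves s) : x ∈ B := (h1.mem_iff hedge b hbs x hx).1 hb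
      have htB (x) (hx : x ∈ leaves t) : x ∉ B := by
        obtain ⟨c, hc⟩ := hC.nonempty
        have hcB : c ∉ B := fun h => Finset.disjoint_left.1 hBC h hc
        have hct : c ∈ leaves t := ((hm c).2 (.inr hc)).resolve_left fun h => hcB (hsB c h)
        exact fun hxB => hcB ((h2.mem_iff hedge x hx c hct).1 hxB)
      have e1 : leaves s = B.val := (Multiset.Nodup.ext hd.1 B.nodup).2 fun x =>
        ⟨hsB x, fun hx => ((hm x).2 (.inl hx)).resolve_right fun h => htB x h hx⟩
      have e2 : leaves t = C.val := (Multiset.Nodup.ext hd.2.1 C.nodup).2 fun x =>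
        ⟨fun hx => ((hm x).1 (.inr hx)).resolve_left (htB x hx),
          fun hx => ((hm x).2 (.inr hx)).resolve_left fun h =>
            Finset.disjoint_left.1 hBC (hsB x h) hx⟩
      exact ⟨s, t, (split_eq_some_iff h).2 ⟨rfl, e1, e2⟩, (hcongr₁ e1).1 h1, (hcongr₂ e2).1 h2⟩
  · rintro ⟨p, q, hpq, hp, hq⟩
    obtain ⟨rfl, e1, e2⟩ := (split_eq_some_iff h).1 hpq
    refine sep_node.2 ⟨(hcongr₁ e1).2 hp, (hcongr₂ e2).2 hq, fun a ha b hb hab => ?_⟩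
    rw [e1] at ha
    rw [e2] at hb
    exact Finset.disjoint_left.1 hBC ((hedge a b hab).1 ha) hb

open Classical in
/-- If the sums of coefficients over the trees admitting a two-component forest vanish, so do the
coefficients. -/
theorem apply_node_eq_zero {c : CommTree V →₀ K} {B C : Finset V} (hc : SupportedOn K (B ∪ C) c)
    (hBC : Disjoint B C) (hne : B ≠ C) (hB : Separated K B) (hC : Separated K C)
    (h : ∀ g₁ g₂, TreeOn B g₁ → TreeOn C g₂ → ev K (Sep (g₁ ⊔ g₂)) c = 0)
    {p q : CommTree V} (hp : leaves p = B.val) (hq : leaves q = C.val) : c (node p q) = 0 := by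
  -- The coefficients form a tensor indexed by the two root subtrees. Pairing the second factor with
  -- `g₂` leaves a combination on `B` that vanishes on all tests, hence is zero.
  have h1 (g₂) (hg₂ : TreeOn C g₂) : linPartial K (fun t => (split B C hne t).bind fun x =>
      if Adm g₂ x.2 then some x.1 else none) c = 0 := by
    refine hB _ (supportedOn_linPartial fun t ht t' ht' => ?_) fun g₁ hg₁ => ?_
    · obtain ⟨⟨x, y⟩, hx, hxy⟩ := Option.bind_eq_some_iff.1 ht'
      split_ifs at hxy
      obtain rfl := Option.some.inj hxy
      exact ((split_eq_some_iff hne).1 hx).2.1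
    · rw [ev_linPartial, ← h g₁ g₂ hg₁ hg₂]
      refine ev_congr fun t ht => ?_
      rw [sep_sup_iff hg₁ hg₂ hBC hne (hc t ht)]
      constructor
      · rintro ⟨t', ht', h3⟩
        obtain ⟨⟨x, y⟩, hx, hxy⟩ := Option.bind_eq_some_iff.1 ht'
        split_ifs at hxy with h4
        obtain rfl := Option.some.inj hxy
        exact ⟨x, y, hx, h3, h4⟩
      · rintro ⟨x, y, hx, h3, h4⟩
        exact ⟨x, by simp [hx, h4], h3⟩
  -- Fixing the first factor to be `p` gives a combination on `C`, whose test by `g₂` is the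
  -- coefficient of `p` in `h1`.
  have h2 : linPartial K (fun t => (split B C hne t).bind fun x =>
      if x.1 = p then some x.2 else none) c = 0 := by
    refine hC _ (supportedOn_linPartial fun t ht t' ht' => ?_) fun g₂ hg₂ => ?_
    · obtain ⟨⟨x, y⟩, hx, hxy⟩ := Option.bind_eq_some_iff.1 ht'
      split_ifs at hxy
      obtain rfl := Option.some.inj hxy
      exact ((split_eq_some_iff hne).1 hx).2.2
    · have := DFunLike.congr_fun (h1 g₂ hg₂) p
      rw [linPartial_apply, Finsupp.zero_apply] at this
      rw [ev_linPartial, ← this]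
      refine ev_congr fun t ht => ?_
      cases split B C hne t with
      | none => simp
      | some x =>
        by_cases hx : x.1 = p <;> by_cases hg : Adm g₂ x.2 <;> simp [hx, hg]
  have := DFunLike.congr_fun h2 q
  rw [linPartial_apply, Finsupp.zero_apply] at this
  rw [← this, ← ev_eq]
  refine ev_congr fun t ht => ?_
  constructor
  · rintro rfl
    rw [(split_eq_some_iff hne).2 ⟨rfl, hp, hq⟩]
    simp
  · intro ht'
    obtain ⟨⟨x, y⟩, hx, hxy⟩ := Option.bind_eq_some_iff.1 ht'
    split_ifs at hxy with h4
    obtain rfl := Option.some.inj hxy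
    obtain rfl : x = p := h4
    exact ((split_eq_some_iff hne).1 hx).1

/-- Strong induction on `A` serves twice: for `A` minus one vertex, to make the forest sums vanish,
and for the two leaf sets at the root, to pass from these sums to coefficients. -/
theorem separated [CharZero K] (A : Finset V) : Separated K A := by
  induction A using Finset.strongInduction with
  | H A ih =>
    intro c hc h
    rw [← Finsupp.support_eq_empty, Finset.eq_empty_iff_forall_notMem]
    intro t ht
    rcases (by
      induction t using ind with
      | hl v => exact .inl ⟨v, rfl⟩
      | hn s t _ _ => exact .inr ⟨s, t, rfl⟩ :
        (∃ v, t = leaf v) ∨ ∃ p q, t = node p q) with ⟨v, rfl⟩ | ⟨p, q, rfl⟩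
    · have hA : A = {v} := Finset.val_injective (hc _ ht).symm
      subst hA
      -- The one-vertex graph is admitted by the only tree on `{v}`, so this test reads off its
      -- coefficient.
      have := h ⊥ (.single v)
      rw [ev_congr (q := fun t => t = leaf v), ev_eq] at this
      · exact Finsupp.mem_support_iff.1 ht this
      · intro t ht
        have := eq_leaf_of_leaves (hc t ht)
        subst this
        exact iff_of_true (adm_leaf _ _) rfl
    · have hd := hc.nodup ht
      rw [leaves_node, Multiset.nodup_add, Multiset.disjoint_left] at hd
      obtain ⟨a, ha⟩ := exists_mem_leaves p
      obtain ⟨b, hb⟩ := exists_mem_leaves q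
      obtain ⟨B, hB⟩ : ∃ B : Finset V, leaves p = B.val := ⟨⟨_, hd.1⟩, rfl⟩
      obtain ⟨C, hC⟩ : ∃ C : Finset V, leaves q = C.val := ⟨⟨_, hd.2.1⟩, rfl⟩
      rw [hB] at ha
      rw [hC] at hb
      have hBC : Disjoint B C := Finset.disjoint_left.2 fun x hx hx' =>
        hd.2.2 (by rw [hB]; exact hx) (by rw [hC]; exact hx')
      have hA : B ∪ C = A := by
        ext x
        rw [← hc.mem ht, leaves_node, Multiset.mem_add, hB, hC, Finset.mem_union,
          Finset.mem_val, Finset.mem_val]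
      have haC : a ∉ C := Finset.disjoint_left.1 hBC ha
      have hbB : b ∉ B := Finset.disjoint_right.1 hBC hb
      refine Finsupp.mem_support_iff.1 ht (apply_node_eq_zero (hA.symm ▸ hc) hBC ?_ ?_ ?_ ?_ hB hC)
      · rintro rfl
        exact haC ha
      · exact ih B (hA ▸ ⟨Finset.subset_union_left, fun h => hbB (h (Finset.mem_union_right _ hb))⟩)
      · exact ih C (hA ▸ ⟨Finset.subset_union_right, fun h => haC (h (Finset.mem_union_left _ ha))⟩)
      · exact fun g₁ g₂ hg₁ hg₂ => ev_sep_eq_zero hc h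
          (fun v hv => ih _ (Finset.erase_ssubset hv)) hg₁ hg₂ hBC hA

end linear

end CommTree

/-! ### The product on an operad defined by a binary element -/

namespace LinearOperad

variable {K : Type u} [Field K] (P : LinearOperad.{u, v, w} K)

theorem map_congr {U V V' W : Type v} [Finite U] [Finite V] [Finite V'] [Finite W] {σ : U ≃ V}
    {τ : V ≃ W} {σ' : U ≃ V'} {τ' : V' ≃ W} (h : ∀ x, τ (σ x) = τ' (σ' x)) (x : P.obj U) :
    P.map τ (P.map σ x) = P.map τ' (P.map σ' x) := by
  rw [← P.map_trans, ← P.map_trans]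
  congr 2
  ext x
  exact h x

theorem map_map_eq {U V W : Type v} [Finite U] [Finite V] [Finite W] {σ : U ≃ V}
    {τ : V ≃ W} {ρ : U ≃ W} (h : ∀ x, τ (σ x) = ρ x) (x : P.obj U) :
    P.map τ (P.map σ x) = P.map ρ x := by
  rw [← P.map_trans]
  congr 2
  ext x
  exact h x

theorem map_eq_self {V : Type v} [Finite V] {σ : V ≃ V} (h : ∀ x, σ x = x) (x : P.obj V) :
    P.map σ x = x := by
  rw [show σ = Equiv.refl V from Equiv.ext h, P.map_refl]

theorem map_symm_apply {V W : Type v} [Finite V] [Finite W] (σ : V ≃ W) (x : P.obj V) :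
    P.map σ.symm (P.map σ x) = x := by
  rw [← P.map_trans, Equiv.self_trans_symm, P.map_refl]

theorem map_apply_symm {V W : Type v} [Finite V] [Finite W] (σ : V ≃ W) (x : P.obj W) :
    P.map σ (P.map σ.symm x) = x := by
  rw [← P.map_trans, Equiv.symm_trans_self, P.map_refl]

theorem circ_map_left {A A' B : Type v} [Finite A] [Finite A'] [Finite B]
    (σ : A ≃ A') (x : P.obj (Option A)) (y : P.obj B) :
    P.circ (P.map (Equiv.optionCongr σ) x) y =
      P.map (Equiv.sumCongr σ (Equiv.refl B)) (P.circ x y) := by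
  rw [← P.circ_natural, P.map_refl]

theorem circ_map_right {A B B' : Type v} [Finite A] [Finite B] [Finite B']
    (τ : B ≃ B') (x : P.obj (Option A)) (y : P.obj B) :
    P.circ x (P.map τ y) = P.map (Equiv.sumCongr (Equiv.refl A) τ) (P.circ x y) := by
  rw [← P.circ_natural, Equiv.optionCongr_refl, P.map_refl]

/-- The product of two elements defined by a binary element `z`: the composition of `z` with
both. -/
def mul (z : P.obj (Option (Option PEmpty.{v + 1}))) {A B : Type v} [Finite A] [Finite B]
    (x : P.obj A) (y : P.obj B) : P.obj (A ⊕ B) :=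
  P.map (Equiv.sumCongr (Equiv.emptySum PEmpty A) (Equiv.refl B))
    (P.circ (P.map (starLeft PEmpty A) (P.circ z x)) y)

variable {P} (z : P.obj (Option (Option PEmpty.{v + 1})))

theorem mul_map {A A' B B' : Type v} [Finite A] [Finite A'] [Finite B] [Finite B']
    (σ : A ≃ A') (τ : B ≃ B') (x : P.obj A) (y : P.obj B) :
    P.mul z (P.map σ x) (P.map τ y) = P.map (Equiv.sumCongr σ τ) (P.mul z x y) := by
  unfold mul
  have h : P.map (starLeft PEmpty A') (P.circ z (P.map σ x)) =
      P.map (Equiv.optionCongr (Equiv.sumCongr (Equiv.refl PEmpty) σ))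
        (P.map (starLeft PEmpty A) (P.circ z x)) := by
    rw [circ_map_right]
    refine P.map_congr ?_ _
    rintro ((_ | _) | _) <;> rfl
  rw [h, P.circ_natural]
  refine P.map_congr ?_ _
  rintro ((_ | _) | _) <;> first | rfl | contradiction

/-- Parallel associativity exchanges the two insertions at the cost of swapping the inputs of `z`,
and the symmetry of `z` absorbs the swap. -/
theorem mul_comm (hz : P.map (starSwap PEmpty) z = z) {A B : Type v} [Finite A] [Finite B]
    (x : P.obj A) (y : P.obj B) : P.map (Equiv.sumComm A B) (P.mul z x y) = P.mul z y x := by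
  unfold mul
  rw [P.circ_parallel, hz, ← P.map_trans, ← P.map_trans]
  congr 2
  ext ((_ | _) | _) <;> first | rfl | contradiction

/-- Parallel associativity inserts `w` before `y`, and sequential associativity, in `h3`, absorbs it
into `x`. The rest matches relabellings. -/
theorem circ_mul {A B C : Type v} [Finite A] [Finite B] [Finite C]
    (x : P.obj (Option A)) (y : P.obj B) (w : P.obj C) :
    P.circ (P.map (starLeft A B) (P.mul z x y)) w =
      P.map (sumSwapRight A B C) (P.mul z (P.circ x w) y) := by
  unfold mul
  have h1 : P.map (starLeft A B) (P.map (Equiv.sumCongr (Equiv.emptySum PEmpty (Option A))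
      (Equiv.refl B)) (P.circ (P.map (starLeft PEmpty (Option A)) (P.circ z x)) y)) =
      P.map (Equiv.optionCongr (Equiv.sumCongr (Equiv.emptySum PEmpty A) (Equiv.refl B)))
        (P.map (starLeft (PEmpty ⊕ A) B) (P.circ (P.map (Equiv.optionCongr (starRight PEmpty A))
          (P.map (starLeft PEmpty (Option A)) (P.circ z x))) y)) := by
    rw [circ_map_left, ← P.map_trans, ← P.map_trans, ← P.map_trans]
    congr 2
    ext ((_ | _ | _) | _) <;> first | rfl | contradiction
  have h2 : P.map (starSwap (PEmpty ⊕ A)) (P.map (Equiv.optionCongr (starRight PEmpty A))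
      (P.map (starLeft PEmpty (Option A)) (P.circ z x))) =
      P.map (Equiv.optionCongr (starLeft PEmpty A))
        (P.map (starRight (Option PEmpty) A) (P.circ z x)) := by
    rw [← P.map_trans, ← P.map_trans, ← P.map_trans]
    congr 2
    ext ((_ | _) | (_ | _)) <;> rfl
  have h3 : P.map (starLeft (PEmpty ⊕ A) C) (P.circ (P.map (Equiv.optionCongr (starLeft PEmpty A))
        (P.map (starRight (Option PEmpty) A) (P.circ z x))) w) =
      P.map (Equiv.optionCongr (Equiv.sumAssoc PEmpty A C).symm)
        (P.map (starLeft PEmpty (A ⊕ C)) (P.circ z (P.circ x w))) := by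
    rw [circ_map_left, ← P.circ_sequential, ← P.map_trans, ← P.map_trans, ← P.map_trans]
    congr 2
    ext (((_ | _) | _) | _) <;> rfl
  rw [h1, circ_map_left, P.circ_parallel, h2, h3, circ_map_left, ← P.map_trans, ← P.map_trans,
    ← P.map_trans]
  congr 2
  ext ((_ | (_ | _)) | _) <;> first | rfl | contradiction

/-- The bijection from the inputs of a binary element to a two-point set. -/
def starsEquiv : Option (Option PEmpty.{v + 1}) ≃ PUnit.{v + 1} ⊕ PUnit.{v + 1} where
  toFun
    | none => .inl ⟨⟩
    | some _ => .inr ⟨⟩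
  invFun
    | .inl _ => none
    | .inr _ => some none
  left_inv := by rintro (_ | _ | _) <;> first | rfl | contradiction
  right_inv := by rintro (_ | _) <;> rfl

theorem circ_unit' {A : Type v} [Finite A] (x : P.obj (Option A)) :
    P.circ x (P.unit PUnit) = P.map (Equiv.optionEquivSumPUnit A) x := by
  rw [← P.circ_unit (B := PUnit.{v + 1}) x, P.map_eq_self]
  rintro (_ | _) <;> rfl

theorem mul_unit_unit : P.mul z (P.unit PUnit) (P.unit PUnit) = P.map starsEquiv z := by
  unfold mul
  rw [circ_unit', circ_unit', ← P.map_trans, ← P.map_trans, ← P.map_trans]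
  congr 2
  ext (_ | _ | _) <;> first | rfl | contradiction

theorem Hom.map_mul {Q : LinearOperad.{u, v, w'} K} (φ : P.Hom Q) {A B : Type v} [Finite A]
    [Finite B] (x : P.obj A) (y : P.obj B) :
    φ.app (A ⊕ B) (P.mul z x y) = Q.mul (φ.app _ z) (φ.app A x) (φ.app B y) := by
  unfold mul
  rw [φ.natural, φ.app_circ, φ.natural, φ.app_circ]

end LinearOperad

theorem CommTree.IsBijective.mul {A B : Type v} {s : CommTree A} {t : CommTree B}
    (hs : s.IsBijective) (ht : t.IsBijective) :
    (node (graft s fun a => leaf (Sum.inl a : A ⊕ B))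
      (graft t fun b => leaf (Sum.inr b : A ⊕ B))).IsBijective := by
  unfold IsBijective
  simp only [leaves_node, leaves_graft, leaves_leaf, Multiset.bind_singleton]
  refine ⟨Multiset.nodup_add.2 ⟨hs.1.map Sum.inl_injective, ht.1.map Sum.inr_injective, ?_⟩, ?_⟩
  · simp [Multiset.disjoint_left]
  · rintro (a | b)
    · simpa using hs.2 a
    · simpa using ht.2 b

/-! ### Positions of the leaves of planar trees -/

namespace PlanarTree

variable {V W : Type v}

/-- The leaves of a planar tree. -/
def Pos : PlanarTree V → Type v
  | .leaf _ => PUnit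
  | .node s t => Pos s ⊕ Pos t

instance finite_pos : (t : PlanarTree V) → Finite (Pos t)
  | .leaf _ => inferInstanceAs (Finite PUnit)
  | .node s t =>
    have := finite_pos s
    have := finite_pos t
    inferInstanceAs (Finite (Pos s ⊕ Pos t))

/-- The label of a leaf. -/
def lab : (t : PlanarTree V) → Pos t → V
  | .leaf v => fun _ => v
  | .node s t => Sum.elim (lab s) (lab t)

/-- The relabelling of the leaves. -/
def relabel (f : V → W) : PlanarTree V → PlanarTree W
  | .leaf v => .leaf (f v)
  | .node s t => .node (relabel f s) (relabel f t)

/-- The tree whose leaves are labelled by themselves. -/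
def canonical : (t : PlanarTree V) → PlanarTree (Pos t)
  | .leaf _ => .leaf PUnit.unit
  | .node s t => .node (relabel Sum.inl (canonical s)) (relabel Sum.inr (canonical t))

/-- The nonplanar tree represented by a planar tree. -/
def toComm (t : PlanarTree V) : CommTree V := Quotient.mk _ t

theorem toComm_node (s t : PlanarTree V) :
    toComm (.node s t) = CommTree.node (toComm s) (toComm t) := rfl

theorem toComm_relabel (f : V → W) (t : PlanarTree V) :
    toComm (relabel f t) = CommTree.graft (toComm t) fun v => CommTree.leaf (f v) := by
  induction t with
  | leaf v => rfl
  | node s t hs ht => rw [relabel, toComm_node, hs, ht, toComm_node, CommTree.graft_node]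

theorem relabel_relabel {X : Type v} (f : V → W) (g : W → X) (t : PlanarTree V) :
    relabel g (relabel f t) = relabel (g ∘ f) t := by
  induction t with
  | leaf v => rfl
  | node s t hs ht => rw [relabel, relabel, relabel, hs, ht]

theorem relabel_canonical (t : PlanarTree V) : relabel (lab t) (canonical t) = t := by
  induction t with
  | leaf v => rfl
  | node s t hs ht =>
    exact congrArg₂ node ((relabel_relabel _ _ _).trans hs) ((relabel_relabel _ _ _).trans ht)

theorem mem_leaves_iff (t : PlanarTree V) (v : V) :
    v ∈ CommTree.leaves (toComm t) ↔ ∃ p, lab t p = v := by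
  induction t with
  | leaf w =>
    change v ∈ CommTree.leaves (CommTree.leaf w) ↔ _
    rw [CommTree.leaves_leaf, Multiset.mem_singleton]
    exact ⟨fun h => ⟨⟨⟩, h.symm⟩, fun ⟨_, h⟩ => h.symm⟩
  | node s t hs ht =>
    rw [toComm_node, CommTree.leaves_node, Multiset.mem_add, hs, ht]
    exact (Sum.exists (p := fun p => Sum.elim (lab s) (lab t) p = v)).symm

theorem lab_injective {t : PlanarTree V} (ht : (CommTree.leaves (toComm t)).Nodup) :
    Function.Injective (lab t) := by
  induction t with
  | leaf w => exact fun _ _ _ => rfl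
  | node s t hs ht' =>
    rw [toComm_node, CommTree.leaves_node, Multiset.nodup_add, Multiset.disjoint_left] at ht
    refine Function.Injective.sumElim (hs ht.1) (ht' ht.2.1) fun a b hab => ?_
    exact ht.2.2 ((mem_leaves_iff s _).2 ⟨a, rfl⟩) ((mem_leaves_iff t _).2 ⟨b, hab.symm⟩)

/-- The bijection from the leaves of a tree to their labels. -/
noncomputable def labEquiv (t : PlanarTree V) (ht : (toComm t).IsBijective) : Pos t ≃ V :=
  Equiv.ofBijective (lab t) ⟨lab_injective ht.1, fun v => (mem_leaves_iff t v).1 (ht.2 v)⟩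

theorem isBijective_canonical (t : PlanarTree V) : (toComm (canonical t)).IsBijective := by
  induction t with
  | leaf v => exact ⟨Multiset.nodup_singleton _, fun v => Multiset.mem_singleton.2 rfl⟩
  | node s t hs ht =>
    have := hs.mul ht
    rw [← toComm_relabel, ← toComm_relabel] at this
    exact this

variable {K : Type u} [Field K] (P : LinearOperad.{u, v, w} K)
  (z : P.obj (Option (Option PEmpty.{v + 1})))

/-- The evaluation of a planar tree in an operad, all nodes being replaced by `z`. -/
def eval : (t : PlanarTree V) → P.obj (Pos t)
  | .leaf _ => P.unit PUnit
  | .node s t => P.mul z (eval s) (eval t)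

variable {P z}

/-- Positions do not depend on labels, but the two position types are not definitionally equal,
hence a bijection compatible with labels and values. -/
theorem exists_pos_relabel (f : V → W) (t : PlanarTree V) : ∃ e : Pos t ≃ Pos (relabel f t),
    (∀ p, lab (relabel f t) (e p) = f (lab t p)) ∧
      P.map e (eval P z t) = eval P z (relabel f t) := by
  induction t with
  | leaf v => exact ⟨Equiv.refl _, fun _ => rfl, P.map_refl _⟩
  | node s t hs ht =>
    obtain ⟨e, h1, h2⟩ := hs
    obtain ⟨e', h1', h2'⟩ := ht
    refine ⟨Equiv.sumCongr e e', ?_, ?_⟩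
    · rintro (p | p)
      · exact h1 p
      · exact h1' p
    · refine (LinearOperad.mul_map z e e' _ _).symm.trans ?_
      rw [h2, h2']
      rfl

/-- Only the `swap` case uses the symmetry of `z`. Keeping track of the labels makes the bijection
unique when labels are distinct, which is what evaluation of nonplanar trees needs. -/
theorem Equivalent.exists_pos (hz : P.map (starSwap PEmpty) z = z) {s t : PlanarTree V}
    (h : Equivalent s t) : ∃ e : Pos s ≃ Pos t,
      (∀ p, lab t (e p) = lab s p) ∧ P.map e (eval P z s) = eval P z t := by
  induction h with
  | refl s => exact ⟨Equiv.refl _, fun _ => rfl, P.map_refl _⟩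
  | symm _ h =>
    obtain ⟨e, h1, h2⟩ := h
    refine ⟨e.symm, fun p => ?_, ?_⟩
    · rw [← h1, Equiv.apply_symm_apply]
    · rw [← h2, P.map_symm_apply]
  | trans _ _ h h' =>
    obtain ⟨e, h1, h2⟩ := h
    obtain ⟨e', h1', h2'⟩ := h'
    refine ⟨e.trans e', fun p => ?_, ?_⟩
    · rw [← h1, ← h1', Equiv.trans_apply]
    · rw [P.map_trans, h2, h2']
  | swap s t =>
    refine ⟨Equiv.sumComm _ _, ?_, LinearOperad.mul_comm z hz _ _⟩
    rintro (p | p) <;> rfl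
  | congr _ _ h h' =>
    obtain ⟨e, h1, h2⟩ := h
    obtain ⟨e', h1', h2'⟩ := h'
    refine ⟨Equiv.sumCongr e e', ?_, ?_⟩
    · rintro (p | p)
      · exact h1 p
      · exact h1' p
    · refine (LinearOperad.mul_map z e e' _ _).symm.trans ?_
      rw [h2, h2']
      rfl

end PlanarTree

/-! ### Root grafting and induction in `ComMag` -/

namespace ComMag

variable {V W A B : Type v}

/-- The tree with two given subtrees at the root. -/
def mul [Finite A] [Finite B] (s : ComMag.obj A) (t : ComMag.obj B) : ComMag.obj (A ⊕ B) :=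
  ⟨.node (.graft s.1 fun a => .leaf (.inl a)) (.graft t.1 fun b => .leaf (.inr b)), s.2.mul t.2⟩

/-- The tree on the positions of the leaves of a planar tree. -/
def ofPlanar (t : PlanarTree V) : ComMag.obj (PlanarTree.Pos t) :=
  ⟨PlanarTree.toComm (PlanarTree.canonical t), PlanarTree.isBijective_canonical t⟩

theorem exists_planar [Finite V] (t : ComMag.obj V) : ∃ s : PlanarTree V,
    PlanarTree.toComm s = t.1 := ⟨t.1.out, Quotient.out_eq _⟩

/-- Every tree is obtained from leaves by grafting at the root and relabelling. -/
theorem induction {p : ∀ (V : Type v) [Finite V], ComMag.obj V → Prop}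
    (hmap : ∀ {V W : Type v} [Finite V] [Finite W] (σ : V ≃ W) (t : ComMag.obj V),
      p V t → p W (ComMag.map σ t))
    (hunit : p PUnit (ComMag.unit PUnit))
    (hmul : ∀ {A B : Type v} [Finite A] [Finite B] (s : ComMag.obj A) (t : ComMag.obj B),
      p A s → p B t → p (A ⊕ B) (mul s t))
    (V : Type v) [Finite V] (t : ComMag.obj V) : p V t := by
  obtain ⟨s, hs⟩ := exists_planar t
  have h : p _ (ofPlanar s) := by
    clear hs
    induction s with
    | leaf v => exact hunit
    | node s t hs ht =>
      have e : ofPlanar (.node s t) = mul (ofPlanar s) (ofPlanar t) :=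
        Subtype.ext (congrArg₂ CommTree.node (PlanarTree.toComm_relabel _ _)
          (PlanarTree.toComm_relabel _ _))
      rw [e]
      exact hmul _ _ hs ht
  -- A tree with distinct labels is the tree on its own leaf positions, relabelled.
  have ht : t = ComMag.map (PlanarTree.labEquiv s (hs ▸ t.2)) (ofPlanar s) := by
    exact Subtype.ext (hs.symm.trans ((congrArg PlanarTree.toComm
      (PlanarTree.relabel_canonical s)).symm.trans (PlanarTree.toComm_relabel _ _)))
  rw [ht]
  exact hmap _ _ h

theorem map_mul [Finite A] [Finite B] [Finite V] [Finite W] (σ : A ≃ V) (τ : B ≃ W)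
    (s : ComMag.obj A) (t : ComMag.obj B) :
    mul (ComMag.map σ s) (ComMag.map τ t) = ComMag.map (Equiv.sumCongr σ τ) (mul s t) := by
  refine Subtype.ext ?_
  simp only [mul, ComMag, CommTree.graft_node, CommTree.graft_graft, CommTree.graft_leaf]
  rfl

theorem map_mul_comm [Finite A] [Finite B] (s : ComMag.obj A) (t : ComMag.obj B) :
    ComMag.map (Equiv.sumComm A B) (mul s t) = mul t s := by
  refine Subtype.ext ?_
  simp only [mul, ComMag, CommTree.graft_node, CommTree.graft_graft, CommTree.graft_leaf]
  exact CommTree.node_comm _ _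

theorem circ_mul {C : Type v} [Finite A] [Finite B] [Finite C] (s : ComMag.obj (Option A))
    (t : ComMag.obj B) (r : ComMag.obj C) :
    ComMag.circ (ComMag.map (starLeft A B) (mul s t)) r =
      ComMag.map (sumSwapRight A B C) (mul (ComMag.circ s r) t) := by
  refine Subtype.ext ?_
  simp only [mul, ComMag, CommTree.graft_node, CommTree.graft_graft, CommTree.graft_leaf]
  congr 2
  ext (_ | a) <;> simp [CommTree.insertAt, starLeft, sumSwapRight, CommTree.graft_graft]

/-- The tree with two leaves, on the inputs of a binary element. -/
def cherryStars : ComMag.obj (Option (Option PEmpty.{v + 1})) :=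
  cherry none (some none) (by simp) (by rintro (_ | _ | _) <;> simp; contradiction)

theorem mul_eq_circ [Finite A] [Finite B] (s : ComMag.obj A) (t : ComMag.obj B) :
    mul s t = ComMag.map (Equiv.sumCongr (Equiv.emptySum PEmpty A) (Equiv.refl B))
      (ComMag.circ (ComMag.map (starLeft PEmpty A) (ComMag.circ cherryStars s)) t) := by
  refine Subtype.ext ?_
  simp only [mul, ComMag, cherryStars, cherry, CommTree.graft_node, CommTree.graft_graft,
    CommTree.graft_leaf, CommTree.insertAt, starLeft]
  exact congrArg₂ CommTree.node rfl (CommTree.graft_graft t.1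
    (fun b => CommTree.leaf (Sum.inr b : (PEmpty ⊕ A) ⊕ B))
    fun v => CommTree.leaf ((Equiv.sumCongr (Equiv.emptySum PEmpty A) (Equiv.refl B)) v)).symm

/-! ### Evaluation of trees in an operad -/

section evalTree

variable {K : Type u} [Field K] (P : LinearOperad.{u, v, w} K)
  (z : P.obj (Option (Option PEmpty.{v + 1})))

/-- The evaluation of a tree in an operad, all nodes being replaced by `z`. -/
noncomputable def evalTree [Finite V] (t : ComMag.obj V) : P.obj V :=
  P.map (PlanarTree.labEquiv t.1.out
    (by rw [PlanarTree.toComm, show Quotient.mk _ t.1.out = t.1 from Quotient.out_eq _]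
        exact t.2)) (PlanarTree.eval P z t.1.out)

variable {P z}

/-- Any planar representative computes the value: two representatives are equivalent, and the
bijection to `V` is forced by the labels. -/
theorem evalTree_eq (hz : P.map (starSwap PEmpty) z = z) [Finite V] {t : ComMag.obj V} {s : PlanarTree V}
    (hs : PlanarTree.toComm s = t.1) {e : PlanarTree.Pos s ≃ V}
    (he : ∀ p, e p = PlanarTree.lab s p) : evalTree P z t = P.map e (PlanarTree.eval P z s) := by
  obtain ⟨e', h1, h2⟩ := PlanarTree.Equivalent.exists_pos hz
    (Quotient.exact (hs.trans (Quotient.out_eq t.1).symm))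
  rw [evalTree, ← h2]
  refine P.map_map_eq (fun x => ?_) _
  rw [he, ← h1]
  rfl

theorem evalTree_map (hz : P.map (starSwap PEmpty) z = z) [Finite V] [Finite W] (σ : V ≃ W) (t : ComMag.obj V) :
    evalTree P z (ComMag.map σ t) = P.map σ (evalTree P z t) := by
  obtain ⟨s, hs⟩ := exists_planar t
  obtain ⟨e, h1, h2⟩ := PlanarTree.exists_pos_relabel (P := P) (z := z) σ s
  have ht := hs ▸ t.2
  rw [evalTree_eq hz hs (e := PlanarTree.labEquiv s ht) fun _ => rfl,
    evalTree_eq hz (s := PlanarTree.relabel σ s)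
      (e := e.symm.trans ((PlanarTree.labEquiv s ht).trans σ)), ← h2]
  · refine P.map_congr (fun x => ?_) _
    simp
  · rw [PlanarTree.toComm_relabel, hs]
    rfl
  · intro p
    obtain ⟨p, rfl⟩ := e.surjective p
    rw [h1, Equiv.trans_apply, Equiv.symm_apply_apply]
    rfl

theorem evalTree_unit (hz : P.map (starSwap PEmpty) z = z) : evalTree P z (ComMag.unit PUnit) = P.unit PUnit := by
  rw [evalTree_eq hz (s := .leaf PUnit.unit) rfl (e := Equiv.refl PUnit) fun _ => rfl]
  exact P.map_refl _

theorem evalTree_mul (hz : P.map (starSwap PEmpty) z = z) [Finite A] [Finite B] (s : ComMag.obj A) (t : ComMag.obj B) :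
    evalTree P z (mul s t) = P.mul z (evalTree P z s) (evalTree P z t) := by
  obtain ⟨s', hs⟩ := exists_planar s
  obtain ⟨t', ht⟩ := exists_planar t
  obtain ⟨e, h1, h2⟩ := PlanarTree.exists_pos_relabel (P := P) (z := z)
    (Sum.inl : A → A ⊕ B) s'
  obtain ⟨e', h1', h2'⟩ := PlanarTree.exists_pos_relabel (P := P) (z := z)
    (Sum.inr : B → A ⊕ B) t'
  have hs' := hs ▸ s.2
  have ht' := ht ▸ t.2
  rw [evalTree_eq hz hs (e := PlanarTree.labEquiv s' hs') fun _ => rfl,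
    evalTree_eq hz ht (e := PlanarTree.labEquiv t' ht') fun _ => rfl, LinearOperad.mul_map,
    evalTree_eq hz (s := .node (PlanarTree.relabel Sum.inl s') (PlanarTree.relabel Sum.inr t'))
      (e := (Equiv.sumCongr e e').symm.trans (Equiv.sumCongr (PlanarTree.labEquiv s' hs')
        (PlanarTree.labEquiv t' ht'))), PlanarTree.eval, ← h2, ← h2', LinearOperad.mul_map]
  · refine P.map_map_eq (fun x => ?_) _
    exact congrArg (Equiv.sumCongr _ _) (Equiv.symm_apply_apply (Equiv.sumCongr e e') x)
  · rw [PlanarTree.toComm_node, PlanarTree.toComm_relabel, PlanarTree.toComm_relabel, hs, ht]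
    rfl
  · intro p
    obtain ⟨p, rfl⟩ := (Equiv.sumCongr e e').surjective p
    refine (congrArg (Equiv.sumCongr _ _)
      (Equiv.symm_apply_apply (Equiv.sumCongr e e') p)).trans ?_
    rcases p with p | p
    · exact (h1 p).symm
    · exact (h1' p).symm

/-- Induction on the tree receiving the insertion: composing a product at an input of one factor
means composing that factor, in `ComMag` and in `P` alike. -/
theorem evalTree_circ (hz : P.map (starSwap PEmpty) z = z) [Finite A] [Finite B] (s : ComMag.obj (Option A)) (t : ComMag.obj B) :
    evalTree P z (ComMag.circ s t) = P.circ (evalTree P z s) (evalTree P z t) := by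
  -- The induction cuts the leaf set into a disjoint union, which is never literally of the form
  -- `Option A`; the bijection `e` leaves room for this.
  suffices h : ∀ (W : Type v) [Finite W] (s : ComMag.obj W) (A : Type v) [Finite A]
      (e : W ≃ Option A), evalTree P z (ComMag.circ (ComMag.map e s) t) =
        P.circ (P.map e (evalTree P z s)) (evalTree P z t) by
    have := h _ s A (Equiv.refl _)
    rwa [ComMag.map_refl, P.map_refl] at this
  intro W _ s
  induction W, s using induction with
  | hmap σ s hs =>
    intro A _ e
    rw [evalTree_map hz, ← P.map_trans, ← ComMag.map_trans]
    exact hs A _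
  | hunit =>
    intro A _ e
    have : IsEmpty A := ⟨fun a => Option.some_ne_none a (e.symm.injective rfl)⟩
    rw [evalTree_unit hz, ComMag.unit_natural, P.unit_natural, ComMag.unit_circ, P.unit_circ,
      evalTree_map hz]
  | @hmul A₁ A₂ _ _ s₁ s₂ h₁ h₂ =>
    intro A _ e
    -- By commutativity of the product, the insertion point may be taken in the left factor.
    wlog hn : ∃ a, e (.inl a) = none generalizing A₁ A₂
    · have hn' : ∃ a, ((Equiv.sumComm A₂ A₁).trans e) (.inl a) = none := by
        obtain ⟨a | a, ha⟩ := e.surjective none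
        · exact absurd ⟨a, ha⟩ hn
        · exact ⟨a, ha⟩
      have := this s₂ s₁ h₂ h₁ ((Equiv.sumComm A₂ A₁).trans e) hn'
      rwa [ComMag.map_trans, map_mul_comm, P.map_trans, ← evalTree_map hz, map_mul_comm] at this
    -- Here `A₁'` is the left leaf set without the insertion point, so that `e` becomes a
    -- relabelling of the left factor followed by `starLeft`, the form required by `circ_mul`.
    obtain ⟨A₁', _, e₁, e', rfl⟩ : ∃ (A₁' : Type v) (_ : Finite A₁') (e₁ : A₁ ≃ Option A₁')
        (e' : A₁' ⊕ A₂ ≃ A), e = (Equiv.sumCongr e₁ (Equiv.refl A₂)).trans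
          ((starLeft A₁' A₂).trans (Equiv.optionCongr e')) := by
      classical
      obtain ⟨a, ha⟩ := hn
      let e₁ : A₁ ≃ Option {x // x ≠ a} := (Equiv.optionSubtypeNe a).symm
      let f := ((Equiv.sumCongr e₁ (Equiv.refl A₂)).trans (starLeft {x // x ≠ a} A₂)).symm.trans e
      have hf : f none = none := by
        change e (.inl (e₁.symm none)) = none
        rw [← ha]
        simp [e₁]
      have hf' : Equiv.optionCongr (Equiv.removeNone f) = f := by
        ext1 x
        cases x with
        | none => exact hf.symm
        | some x =>
          refine Equiv.removeNone_some f (Option.ne_none_iff_exists'.1 fun h => ?_)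
          exact Option.some_ne_none x (f.injective (h.trans hf.symm))
      refine ⟨{x // x ≠ a}, inferInstance, e₁, Equiv.removeNone f, ?_⟩
      rw [hf']
      exact Equiv.ext fun x => (congrArg e (Equiv.symm_apply_apply (((Equiv.sumCongr e₁
        (Equiv.refl A₂)).trans (starLeft {x // x ≠ a} A₂))) x)).symm
    have hA : Finite (A₁' ⊕ A₂) := inferInstance
    rw [ComMag.map_trans, ← map_mul, ComMag.map_refl, ComMag.map_trans,
      ← ComMag.map_refl t, ComMag.circ_natural, ComMag.map_refl, circ_mul, evalTree_map hz,
      evalTree_map hz, evalTree_mul hz, h₁, evalTree_mul hz, P.map_trans, ← LinearOperad.mul_map,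
      P.map_refl, P.map_trans, LinearOperad.circ_map_left, LinearOperad.circ_mul]

end evalTree

end ComMag

/-! ### Composition, inverses and images of morphisms -/

namespace LinearOperad

variable {K : Type u} [Field K] {P : LinearOperad.{u, v, w} K}

/-- The composition of two morphisms. -/
def Hom.comp {Q : LinearOperad.{u, v, w'} K} {R : LinearOperad.{u, v, w} K} (ψ : Q.Hom R)
    (φ : P.Hom Q) : P.Hom R where
  app V _ := (ψ.app V).comp (φ.app V)
  natural σ x := by simp only [LinearMap.comp_apply, φ.natural, ψ.natural]
  app_unit V _ := by simp only [LinearMap.comp_apply, φ.app_unit, ψ.app_unit]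
  app_circ x y := by simp only [LinearMap.comp_apply, φ.app_circ, ψ.app_circ]

/-- The inverse of a bijective morphism, as an isomorphism. -/
noncomputable def Hom.isoSymm {Q : LinearOperad.{u, v, w'} K} (φ : P.Hom Q)
    (h : ∀ (V : Type v) [Finite V], Function.Bijective (φ.app V)) : Q.Iso P where
  hom :=
    { app V _ := (LinearEquiv.ofBijective (φ.app V) (h V)).symm
      natural {V W} _ _ σ x := by
        apply (h W).1
        rw [φ.natural]
        exact (LinearEquiv.apply_symm_apply (LinearEquiv.ofBijective _ (h W)) _).trans
          (congrArg _ (LinearEquiv.apply_symm_apply (LinearEquiv.ofBijective _ (h V)) _).symm)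
      app_unit V _ := by
        apply (h V).1
        rw [φ.app_unit]
        exact LinearEquiv.apply_symm_apply (LinearEquiv.ofBijective _ (h V)) _
      app_circ {A B} _ _ x y := by
        apply (h (A ⊕ B)).1
        rw [φ.app_circ]
        exact (LinearEquiv.apply_symm_apply (LinearEquiv.ofBijective _ (h (A ⊕ B))) _).trans
          (congrArg₂ (fun x y => Q.circ x y)
            (LinearEquiv.apply_symm_apply (LinearEquiv.ofBijective _ (h (Option A))) x)
            (LinearEquiv.apply_symm_apply (LinearEquiv.ofBijective _ (h B)) y)).symm }
  inv := φ
  hom_inv V _ x := LinearEquiv.apply_symm_apply (LinearEquiv.ofBijective _ (h V)) x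
  inv_hom V _ y := LinearEquiv.symm_apply_apply (LinearEquiv.ofBijective _ (h V)) y

/-- The inclusion of a suboperad. -/
def Suboperad.subtype (S : P.Suboperad) : S.toOperad.Hom P where
  app V _ := (S.carrier V).subtype
  natural _ _ := rfl
  app_unit _ _ := rfl
  app_circ _ _ := rfl

/-- The image of a morphism. -/
def Hom.range {Q : LinearOperad.{u, v, w'} K} (φ : P.Hom Q) : Q.Suboperad where
  carrier V _ := LinearMap.range (φ.app V)
  map_mem := by
    rintro V W _ _ σ _ ⟨x, rfl⟩
    exact ⟨P.map σ x, φ.natural σ x⟩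
  unit_mem V _ := ⟨P.unit V, φ.app_unit V⟩
  circ_mem := by
    rintro A B _ _ _ _ ⟨x, rfl⟩ ⟨y, rfl⟩
    exact ⟨P.circ x y, φ.app_circ x y⟩

theorem mem_generated {ι : Type*} {V : ι → Type v} [∀ i, Finite (V i)]
    {x : ∀ i, P.obj (V i)} (i : ι) : x i ∈ (P.generated V x).carrier (V i) :=
  (Submodule.mem_iInf _).2 fun S => S.2 i

theorem generated_le {ι : Type*} {V : ι → Type v} [∀ i, Finite (V i)]
    {x : ∀ i, P.obj (V i)} {S : P.Suboperad} (hS : ∀ i, x i ∈ S.carrier (V i)) {W : Type v}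
    [Finite W] {y : P.obj W} (hy : y ∈ (P.generated V x).carrier W) : y ∈ S.carrier W :=
  (Submodule.mem_iInf _).1 hy ⟨S, hS⟩

end LinearOperad

/-! ### The universal property of `ComMag` -/

namespace ComMag

variable {K : Type u} [Field K] {V W A B : Type v}

variable (K) in
/-- A tree, as a basis element of `K ComMag`. -/
noncomputable def ofTree [Finite V] (t : ComMag.obj V) : (ComMag.{v}.linearize K).obj V :=
  Finsupp.single t (1 : K)

theorem map_ofTree [Finite V] [Finite W] (σ : V ≃ W) (t : ComMag.obj V) :
    (ComMag.{v}.linearize K).map σ (ofTree K t) = ofTree K (ComMag.map σ t) :=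
  SetSpecies.linMap_single _ _ _ _

theorem circ_ofTree [Finite A] [Finite B] (s : ComMag.obj (Option A)) (t : ComMag.obj B) :
    (ComMag.{v}.linearize K).circ (ofTree K s) (ofTree K t) = ofTree K (ComMag.circ s t) := by
  have : bilin K (fun (s : ComMag.obj (Option A)) (t : ComMag.obj B) =>
      Finsupp.single (ComMag.circ s t) (1 : K)) (Finsupp.single s 1) (Finsupp.single t 1) =
      Finsupp.single (ComMag.circ s t) 1 := by
    rw [bilin_single, one_smul, one_smul]
  exact this

theorem mul_ofTree [Finite A] [Finite B] (s : ComMag.obj A) (t : ComMag.obj B) :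
    (ComMag.{v}.linearize K).mul (ofTree K cherryStars) (ofTree K s) (ofTree K t) =
      ofTree K (mul s t) := by
  rw [mul_eq_circ, ← map_ofTree, ← circ_ofTree, ← map_ofTree, ← circ_ofTree]
  rfl

section hom

variable {P : LinearOperad.{u, v, w} K}

/-- Trees are built from units by relabelling and products, and a morphism respects all three once
its value on the cherry is fixed. -/
theorem hom_ext {φ ψ : (ComMag.{v}.linearize K).Hom P}
    (h : φ.app _ (ofTree K cherryStars) =
      ψ.app _ (ofTree K cherryStars)) : φ = ψ := by
  have key (V : Type v) [Finite V] (t : ComMag.obj V) :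
      φ.app V (ofTree K t) = ψ.app V (ofTree K t) := by
    induction V, t using induction with
    | hmap σ t ht => rw [← map_ofTree, φ.natural, ψ.natural, ht]
    | hunit => exact (φ.app_unit PUnit).trans (ψ.app_unit PUnit).symm
    | hmul s t hs ht =>
      rw [← mul_ofTree, LinearOperad.Hom.map_mul, LinearOperad.Hom.map_mul, h, hs, ht]
  have : @LinearOperad.Hom.app _ _ _ _ φ = @LinearOperad.Hom.app _ _ _ _ ψ := by
    funext V _
    exact Finsupp.lhom_ext' fun t => LinearMap.ext_ring (key V t)
  cases φ
  cases ψ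
  congr

theorem eq_map_cherryStars {a b : V} [Finite V] (hab : a ≠ b) (hV : ∀ v, v = a ∨ v = b) :
    ∃ e : Option (Option PEmpty.{v + 1}) ≃ V, cherry a b hab hV = ComMag.map e cherryStars := by
  refine ⟨Equiv.ofBijective (fun o => o.elim a fun _ => b) ⟨?_, fun v => ?_⟩, rfl⟩
  · rintro (_ | _ | _) (_ | _ | _) h <;>
      first | rfl | contradiction | exact absurd h hab | exact absurd h.symm hab
  · rcases hV v with rfl | rfl
    · exact ⟨none, rfl⟩
    · exact ⟨some none, rfl⟩

/-- The morphism that sends the tree with two leaves to a given symmetric element. -/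
noncomputable def evalHom (z : P.obj (Option (Option PEmpty.{v + 1})))
    (hz : P.map (starSwap PEmpty) z = z) : (ComMag.{v}.linearize K).Hom P where
  app V _ := Finsupp.linearCombination K (fun t : ComMag.obj V => evalTree P z t)
  natural {V W} _ _ σ := by
    have (x : ComMag.obj V →₀ K) : Finsupp.linearCombination K
        (fun t : ComMag.obj W => evalTree P z t) (ComMag.linMap K σ x) =
        P.map σ (Finsupp.linearCombination K (fun t : ComMag.obj V => evalTree P z t) x) := by
      induction x using Finsupp.induction_linear with
      | zero => simp
      | add x y hx hy => simp only [map_add, hx, hy]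
      | single t r =>
        rw [SetSpecies.linMap_single, Finsupp.linearCombination_single,
          Finsupp.linearCombination_single, evalTree_map hz, map_smul]
    exact this
  app_unit V _ := by
    have : Finsupp.linearCombination K (fun t : ComMag.obj V => evalTree P z t)
        (Finsupp.single (ComMag.unit V) 1) = P.unit V := by
      rw [Finsupp.linearCombination_single, one_smul,
        ← ComMag.unit_natural (Equiv.ofUnique PUnit.{v + 1} V), evalTree_map hz,
        evalTree_unit hz, P.unit_natural]
    exact this
  app_circ {A B} _ _ := by
    have (x : ComMag.obj (Option A) →₀ K) (y : ComMag.obj B →₀ K) : Finsupp.linearCombination K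
        (fun t : ComMag.obj (A ⊕ B) => evalTree P z t)
          (bilin K (fun s t => Finsupp.single (ComMag.circ s t) 1) x y) =
        P.circ (Finsupp.linearCombination K (fun t : ComMag.obj (Option A) => evalTree P z t) x)
          (Finsupp.linearCombination K (fun t : ComMag.obj B => evalTree P z t) y) := by
      induction x using Finsupp.induction_linear with
      | zero => simp
      | add x x' hx hx' => simp only [map_add, LinearMap.add_apply, hx, hx']
      | single s r =>
        induction y using Finsupp.induction_linear with
        | zero => simp
        | add y y' hy hy' => simp only [map_add, hy, hy']
        | single t r' =>
          simp only [bilin_single, map_smul, Finsupp.linearCombination_single, one_smul,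
            evalTree_circ hz, LinearMap.smul_apply, smul_comm r r']
    exact this

theorem evalHom_cherryStars (z : P.obj (Option (Option PEmpty.{v + 1})))
    (hz : P.map (starSwap PEmpty) z = z) :
    (evalHom z hz).app _ (ofTree K cherryStars) = z := by
  have h : (cherryStars : ComMag.obj (Option (Option PEmpty.{v + 1}))) =
      -- The cherry is the product of two units, so its value is `z` with units inserted in both
      -- inputs.
      ComMag.map LinearOperad.starsEquiv.symm (mul (ComMag.unit PUnit) (ComMag.unit PUnit)) := rfl
  refine (Finsupp.linearCombination_single _ _ _).trans ?_
  rw [one_smul, h, evalTree_map hz, evalTree_mul hz, evalTree_unit hz,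
    LinearOperad.mul_unit_unit, P.map_symm_apply]

theorem existsUnique_hom [Finite V] {a b : V} (hab : a ≠ b) (hV : ∀ v, v = a ∨ v = b)
    (x : P.obj V) (hx : ∀ σ : V ≃ V, P.map σ x = x) :
    ∃! φ : (ComMag.{v}.linearize K).Hom P, φ.app V (generator K a b hab hV) = x := by
  obtain ⟨e, he⟩ := eq_map_cherryStars hab hV
  have hg : generator K a b hab hV =
      (ComMag.{v}.linearize K).map e (ofTree K cherryStars) := by
    rw [map_ofTree, ← he]
    rfl
  have hz : P.map (starSwap PEmpty) (P.map e.symm x) = P.map e.symm x := by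
    -- Exchanging the two inputs, transported along `e`, is a permutation of `V`, which fixes `x`.
    conv_rhs => rw [← hx (e.symm.trans ((starSwap PEmpty).trans e))]
    refine P.map_congr (fun y => ?_) _
    simp
  refine ⟨evalHom _ hz, ?_, fun ψ hψ => hom_ext ?_⟩
  · change (evalHom _ hz).app V _ = x
    rw [hg, (evalHom _ hz).natural, evalHom_cherryStars, P.map_apply_symm]
  · rw [evalHom_cherryStars, ← hψ, hg, ψ.natural, P.map_symm_apply]

theorem map_generator [Finite V] {a b : V} (hab : a ≠ b) (hV : ∀ v, v = a ∨ v = b) (σ : V ≃ V) :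
    (ComMag.{v}.linearize K).map σ (generator K a b hab hV) = generator K a b hab hV := by
  refine (map_ofTree _ _).trans (congrArg (ofTree K) ?_)
  refine Subtype.ext ?_
  change CommTree.node (.leaf (σ a)) (.leaf (σ b)) = CommTree.node (.leaf a) (.leaf b)
  have hσ : σ a ≠ σ b := σ.injective.ne hab
  rcases hV (σ a) with h | h <;> rcases hV (σ b) with h' | h'
  · exact absurd (h.trans h'.symm) hσ
  · rw [h, h']
  · rw [h, h', CommTree.node_comm]
  · exact absurd (h.trans h'.symm) hσ

end hom

end ComMag

/-! ### The image of a tree in the graph insertion operad -/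

/-- A graph occurring in an insertion determines both graphs it came from, so no multiplicities
arise and sums of sets compose to sums of sets. -/
theorem bilin_setSum {K : Type u} [Field K] {A B : Type v} [Finite A] [Finite B]
    (s : Set (graphSpecies.obj (Option A))) (t : Set (graphSpecies.obj B)) :
    bilin K (insertion K) (setSum K s) (setSum K t) =
      setSum K {h | ∃ k ∈ s, ∃ l ∈ t, Occurs k.1 l.1 h.1} := by
  classical
  have := Fintype.ofFinite (graphSpecies.obj B)
  have ht : setSum K t = ∑ l : graphSpecies.obj B, if l ∈ t then Finsupp.single l (1 : K) else 0 := by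
    ext x
    rw [Finsupp.finsetSum_apply, setSum_apply, Finset.sum_eq_single x]
    · split_ifs <;> simp
    · intro y _ hy
      split_ifs
      · simp [hy]
      · rfl
    · simp
  rw [ht, map_sum]
  ext h
  have e (l : graphSpecies.obj B) : bilin K (insertion K) (setSum K s)
      (if l ∈ t then Finsupp.single l (1 : K) else 0) h =
      if (l ∈ t ∧ ∃ k ∈ s, Occurs k.1 l.1 h.1) then 1 else 0 := by
    split_ifs with h1 h2 h2
    · rw [bilin_setSum_left, setSum_apply]
      exact if_pos h2.2
    · rw [bilin_setSum_left, setSum_apply]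
      exact if_neg fun h3 => h2 ⟨h1, h3⟩
    · exact absurd h2.1 h1
    · simp
  rw [Finsupp.finsetSum_apply, Finset.sum_congr rfl fun l _ => e l, sum_ite_unique, setSum_apply]
  · refine if_congr ?_ rfl rfl
    constructor
    · rintro ⟨l, hl, k, hk, hkl⟩
      exact ⟨k, hk, l, hl, hkl⟩
    · rintro ⟨k, hk, l, hl, hkl⟩
      exact ⟨l, hl, k, hk, hkl⟩
  · rintro l l' ⟨-, k, -, h1⟩ ⟨-, k', -, h2⟩
    refine Subtype.ext ?_
    ext b b'
    rw [← h1.2.1, ← h2.2.1]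

/-- The graphs that occur in the product of two graphs defined by the segment. -/
theorem exists_occurs_iff {A B : Type v} {g₁ : SimpleGraph A} {g₂ : SimpleGraph B}
    {h : SimpleGraph (A ⊕ B)} :
    (∃ k : SimpleGraph (Option (PEmpty.{v + 1} ⊕ A)),
      Occurs (⊤ : SimpleGraph (Option (Option PEmpty.{v + 1}))) g₁ (k.comap (starLeft PEmpty A)) ∧
      Occurs k g₂ (h.comap (Equiv.sumCongr (Equiv.emptySum PEmpty A) (Equiv.refl B)))) ↔
    h.comap Sum.inl = g₁ ∧ h.comap Sum.inr = g₂ ∧ ∃ a b, h.Adj (.inl a) (.inr b) ∧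
      ∀ a' b', h.Adj (.inl a') (.inr b') → a' = a ∧ b' = b := by
  constructor
  · rintro ⟨k, ⟨-, h2, -, h4, h5⟩, k1, k2, k3, k4, k5⟩
    obtain ⟨a, ha⟩ := h4 none (by simp)
    obtain ⟨b, hb⟩ := k4 (.inr a) ha
    refine ⟨?_, ?_, a, b, hb, fun a' b' hab => ?_⟩
    · ext x y
      exact (k1 (.inr x) (.inr y)).trans (h2 x y)
    · ext x y
      exact k2 x y
    · obtain rfl := h5 none a' a (k3 (.inr a') b' hab) ha
      exact ⟨rfl, k5 (.inr a') b' b hab hb⟩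
  · rintro ⟨rfl, rfl, a, b, hab, hu⟩
    -- The intermediate graph is `g₁` with the remaining input attached to `a`, the left end of the
    -- unique joining edge; inserting `g₂` then sends this edge to `b`.
    refine ⟨(glue (⊥ : SimpleGraph (Option PEmpty.{v + 1})) (h.comap Sum.inl)
      (fun _ x => x = a)).comap (starLeft PEmpty A).symm, ⟨?_, ?_, ?_, ?_, ?_⟩, ?_, ?_, ?_, ?_, ?_⟩
    · rintro (_ | x) (_ | y) <;> first | contradiction | simp [glue, starLeft]
    · exact fun _ _ => Iff.rfl
    · rintro (_ | x) y hy <;> first | contradiction | simp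
    · rintro (_ | x) hx
      · exact ⟨a, rfl⟩
      · contradiction
    · rintro (_ | x) y y' hy hy'
      · exact Eq.trans (b := a) hy (Eq.symm hy')
      · contradiction
    · rintro (x | x) (y | y) <;> first | contradiction | exact Iff.rfl
    · exact fun _ _ => Iff.rfl
    · rintro (x | x) y hy
      · contradiction
      · exact (hu x y hy).1
    · rintro (x | x) hx
      · contradiction
      · obtain rfl : x = a := hx
        exact ⟨b, hab⟩
    · rintro (x | x) y y' hy hy'
      · contradiction
      · exact (hu x y hy).2.trans (hu x y' hy').2.symm

/-! ### Admissibility under relabelling and root grafting -/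

namespace CommTree

variable {V W A B : Type v}

theorem mem_leaves_relabel {t : CommTree V} {f : V → W} {w : W} :
    w ∈ leaves (graft t fun v => leaf (f v)) ↔ ∃ v ∈ leaves t, f v = w := by
  simp only [leaves_graft, leaves_leaf, Multiset.bind_singleton, Multiset.mem_map]

theorem linked_relabel {s t : CommTree V} {f : V → W} (hf : Function.Injective f)
    {g : SimpleGraph W} : Linked g (graft s fun v => leaf (f v)) (graft t fun v => leaf (f v)) ↔
      Linked (g.comap f) s t := by
  simp only [Linked, mem_leaves_relabel, SimpleGraph.comap_adj]
  constructor
  · rintro ⟨_, ⟨a, ha, rfl⟩, _, ⟨b, hb, rfl⟩, hab, h⟩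
    refine ⟨a, ha, b, hb, hab, fun a' ha' b' hb' hab' => ?_⟩
    obtain ⟨h1, h2⟩ := h _ ⟨a', ha', rfl⟩ _ ⟨b', hb', rfl⟩ hab'
    exact ⟨hf h1, hf h2⟩
  · rintro ⟨a, ha, b, hb, hab, h⟩
    refine ⟨_, ⟨a, ha, rfl⟩, _, ⟨b, hb, rfl⟩, hab, ?_⟩
    rintro _ ⟨a', ha', rfl⟩ _ ⟨b', hb', rfl⟩ hab'
    obtain ⟨rfl, rfl⟩ := h a' ha' b' hb' hab'
    exact ⟨rfl, rfl⟩

theorem adm_relabel {t : CommTree V} {f : V → W} (hf : Function.Injective f)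
    {g : SimpleGraph W} : Adm g (graft t fun v => leaf (f v)) ↔ Adm (g.comap f) t := by
  induction t using ind with
  | hl v => exact Iff.rfl
  | hn s t hs ht => rw [graft_node, adm_node, adm_node, hs, ht, linked_relabel hf]

/-- Every element of `A` and of `B` labels a leaf, so the condition at the root ranges over all
pairs. This is the description in `exists_occurs_iff`. -/
theorem adm_mul {s : CommTree A} {t : CommTree B} (hs : s.IsBijective) (ht : t.IsBijective)
    {g : SimpleGraph (A ⊕ B)} :
    Adm g (node (graft s fun a => leaf (.inl a)) (graft t fun b => leaf (.inr b))) ↔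
      Adm (g.comap Sum.inl) s ∧ Adm (g.comap Sum.inr) t ∧ ∃ a b, g.Adj (.inl a) (.inr b) ∧
        ∀ a' b', g.Adj (.inl a') (.inr b') → a' = a ∧ b' = b := by
  rw [adm_node, adm_relabel Sum.inl_injective, adm_relabel Sum.inr_injective]
  simp only [Linked, mem_leaves_relabel]
  refine and_congr_right fun _ => and_congr_right fun _ => ?_
  constructor
  · rintro ⟨_, ⟨a, ha, rfl⟩, _, ⟨b, hb, rfl⟩, hab, h⟩
    refine ⟨a, b, hab, fun a' b' hab' => ?_⟩
    obtain ⟨h1, h2⟩ := h _ ⟨a', hs.2 _, rfl⟩ _ ⟨b', ht.2 _, rfl⟩ hab'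
    exact ⟨Sum.inl_injective h1, Sum.inr_injective h2⟩
  · rintro ⟨a, b, hab, h⟩
    refine ⟨_, ⟨a, hs.2 _, rfl⟩, _, ⟨b, ht.2 _, rfl⟩, hab, ?_⟩
    rintro _ ⟨a', ha', rfl⟩ _ ⟨b', hb', rfl⟩ hab'
    obtain ⟨rfl, rfl⟩ := h a' b' hab'
    exact ⟨rfl, rfl⟩

end CommTree

/-! ### Injectivity and the generated suboperad -/

namespace graphOperad

variable {K : Type u} [Field K] {V W A B : Type v}

variable (K) in
/-- The sum of a set of graphs, as an element of the graph insertion operad. -/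
noncomputable def ofSet [Finite V] (s : Set (graphSpecies.obj V)) :
    (graphOperad.{u, v} K).obj V := setSum K s

theorem map_ofSet [Finite V] [Finite W] (σ : V ≃ W) (s : Set (graphSpecies.obj V)) :
    (graphOperad.{u, v} K).map σ (ofSet K s) =
      ofSet K {g | graphSpecies.map σ.symm g ∈ s} := linMap_setSum σ s

theorem circ_ofSet [Finite A] [Finite B] (s : Set (graphSpecies.obj (Option A)))
    (t : Set (graphSpecies.obj B)) : (graphOperad.{u, v} K).circ (ofSet K s) (ofSet K t) =
      ofSet K {h | ∃ k ∈ s, ∃ l ∈ t, Occurs k.1 l.1 h.1} := bilin_setSum s t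

/-- The complete graph. -/
def top (V : Type v) [Finite V] [Nonempty V] : graphSpecies.obj V := ⟨⊤, ‹_›⟩

/-- The product by the segment adds exactly one joining edge, which is the condition that
admissibility imposes at the new root. -/
theorem mul_ofSet [Finite A] [Finite B] {s : ComMag.obj A} {t : ComMag.obj B} :
    (graphOperad.{u, v} K).mul (ofSet K {top _})
      (ofSet K {g | CommTree.Adm g.1 s.1}) (ofSet K {g | CommTree.Adm g.1 t.1}) =
      ofSet K {g | CommTree.Adm g.1 (ComMag.mul s t).1} := by
  unfold LinearOperad.mul
  rw [circ_ofSet, map_ofSet, circ_ofSet, map_ofSet]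
  congr 1
  ext ⟨h, hne⟩
  refine Iff.trans ?_ (CommTree.adm_mul s.2 t.2).symm
  constructor
  · rintro ⟨k, ⟨_, rfl, l, hl, h1⟩, l', hl', h2⟩
    obtain ⟨h3, h4, h5⟩ := exists_occurs_iff.1 ⟨k.1, h1, h2⟩
    refine ⟨?_, ?_, h5⟩
    · rw [h3]; exact hl
    · rw [h4]; exact hl'
  · rintro ⟨h1, h2, h3⟩
    obtain ⟨k, h4, h5⟩ := exists_occurs_iff.2 ⟨rfl, rfl, h3⟩
    obtain ⟨a, -⟩ := CommTree.exists_mem_leaves s.1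
    obtain ⟨b, -⟩ := CommTree.exists_mem_leaves t.1
    exact ⟨⟨k, ⟨none⟩⟩, ⟨top _, rfl, ⟨_, ⟨a⟩⟩, h1, h4⟩, ⟨_, ⟨b⟩⟩, h2, h5⟩

/-- The image of a tree in the graph insertion operad. -/
theorem app_ofTree (φ : (ComMag.{v}.linearize K).Hom (graphOperad.{u, v} K))
    (hφ : φ.app _ (ComMag.ofTree K ComMag.cherryStars) = ofSet K {top _}) [Finite V]
    (t : ComMag.obj V) :
    φ.app V (ComMag.ofTree K t) = ofSet K {g | CommTree.Adm g.1 t.1} := by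
  induction V, t using ComMag.induction with
  | hmap σ t ht =>
    rw [← ComMag.map_ofTree, φ.natural, ht, map_ofSet]
    congr 1
    ext g
    exact (CommTree.adm_relabel σ.injective).symm
  | hunit =>
    refine (φ.app_unit PUnit).trans ((setSum_singleton _).symm.trans ?_)
    -- There is only one graph on one vertex, and a leaf admits it.
    refine congrArg (setSum K) (Set.ext fun g => iff_of_true (Subtype.ext ?_) trivial)
    exact Subsingleton.elim _ _
  | hmul s t hs ht =>
    rw [← ComMag.mul_ofTree, LinearOperad.Hom.map_mul, hφ, hs, ht, mul_ofSet]

/-- This identifies the sums studied above with the coefficients of the image, so that `separated`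
becomes a statement about the kernel. -/
theorem ev_adm_eq [Finite V] (f : ({t : CommTree V // t.IsBijective} →₀ K) →ₗ[K] (graphSpecies.obj V →₀ K))
    (hf : ∀ t : {t : CommTree V // t.IsBijective},
      f (Finsupp.single t 1) = setSum K {g | CommTree.Adm g.1 t.1})
    (g : graphSpecies.obj V) (c : {t : CommTree V // t.IsBijective} →₀ K) :
    CommTree.ev K (CommTree.Adm g.1) (c.mapDomain Subtype.val) = f c g := by
  classical
  induction c using Finsupp.induction_linear with
  | zero => simp
  | add x y hx hy => rw [Finsupp.mapDomain_add, map_add, hx, hy, map_add, Finsupp.add_apply]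
  | single t r =>
    rw [← mul_one r, ← smul_eq_mul, ← Finsupp.smul_single, map_smul, hf, Finsupp.smul_apply,
      setSum_apply, Finsupp.mapDomain_smul, map_smul, Finsupp.mapDomain_single, CommTree.ev,
      Finsupp.linearCombination_single, one_smul]
    rfl

/-- All coefficients of the image vanish for an element of the kernel; those at graph-theoretic
trees on the full vertex set already suffice for `separated`. -/
theorem app_injective [CharZero K] (φ : (ComMag.{v}.linearize K).Hom (graphOperad.{u, v} K))
    (hφ : φ.app _ (ComMag.ofTree K ComMag.cherryStars) = ofSet K {top _}) (V : Type v)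
    [Finite V] : Function.Injective (φ.app V) := by
  classical
  rw [injective_iff_map_eq_zero]
  intro c hc
  change ComMag.obj V →₀ K at c
  -- On the empty set there is no graph to test with, but there is no tree either.
  rcases isEmpty_or_nonempty V with hV | hV
  · have := ComMag.positive V
    exact Subsingleton.elim (α := ComMag.obj V →₀ K) _ _
  have := Fintype.ofFinite V
  have h0 : c.mapDomain Subtype.val = 0 := by
    refine CommTree.separated (K := K) (Finset.univ : Finset V) _ (fun t ht => ?_) fun g _ => ?_
    · obtain ⟨t, -, rfl⟩ := Finset.mem_image.1 (Finsupp.mapDomain_support ht)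
      exact (Multiset.Nodup.ext t.2.1 Finset.univ.nodup).2 fun v =>
        iff_of_true (t.2.2 v) (Finset.mem_univ v)
    · exact (ev_adm_eq (φ.app V) (app_ofTree φ hφ) ⟨g, hV⟩ c).trans
        (DFunLike.congr_fun (F := graphSpecies.obj V →₀ K) hc _)
  exact Finsupp.mapDomain_injective Subtype.val_injective (h0.trans Finsupp.mapDomain_zero.symm)

theorem segment_eq [Finite V] [Nonempty V] {a b : V} (hab : a ≠ b)
    (hV : ∀ v, v = a ∨ v = b) : segment K a b = ofSet K {top V} := by
  refine Eq.trans ?_ (setSum_singleton _).symm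
  refine congrArg (fun g => Finsupp.single g (1 : K)) (Subtype.ext ?_)
  ext x y
  change (SimpleGraph.edge a b).Adj x y ↔ x ≠ y
  rw [SimpleGraph.edge_adj]
  rcases hV x with rfl | rfl <;> rcases hV y with rfl | rfl <;> simp [hab, hab.symm]

theorem map_ofSet_top [Finite V] [Finite W] [Nonempty V] [Nonempty W] (σ : V ≃ W) :
    (graphOperad.{u, v} K).map σ (ofSet K {top V}) = ofSet K {top W} := by
  rw [map_ofSet]
  congr 1
  ext g
  rw [Set.mem_ofPred_eq, Set.mem_singleton_iff, Set.mem_singleton_iff]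
  constructor
  · intro h
    have := congrArg (graphSpecies.map σ) h
    rw [← graphSpecies.map_trans, Equiv.symm_trans_self, graphSpecies.map_refl] at this
    rw [this]
    refine Subtype.ext ?_
    ext x y
    change σ.symm x ≠ σ.symm y ↔ x ≠ y
    simp
  · rintro rfl
    refine Subtype.ext ?_
    ext x y
    change σ x ≠ σ y ↔ x ≠ y
    simp

/-- The suboperad generated by the segment is isomorphic to `K ComMag`. -/
theorem nonempty_iso [CharZero K] [Finite V] {a b : V} (hab : a ≠ b)
    (hV : ∀ v, v = a ∨ v = b) :
    Nonempty (((graphOperad.{u, v} K).generated (fun _ : Unit => V)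
      (fun _ => segment K a b)).toOperad.Iso (ComMag.{v}.linearize K)) := by
  have : Nonempty V := ⟨a⟩
  set S := (graphOperad.{u, v} K).generated (fun _ : Unit => V) (fun _ => segment K a b) with hS
  have hmem : segment K a b ∈ S.carrier V :=
    LinearOperad.mem_generated (P := graphOperad.{u, v} K) (V := fun _ : Unit => V)
      (x := fun _ => segment K a b) ()
  obtain ⟨φ, hφ, -⟩ := ComMag.existsUnique_hom (P := S.toOperad) hab hV ⟨segment K a b, hmem⟩
    fun σ => Subtype.ext (by
      change (graphOperad.{u, v} K).map σ (segment K a b) = segment K a b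
      rw [segment_eq hab hV, map_ofSet_top])
  have hψ : (S.subtype.comp φ).app V (ComMag.generator K a b hab hV) = segment K a b :=
    congrArg Subtype.val hφ
  obtain ⟨e, he⟩ := ComMag.eq_map_cherryStars hab hV
  have hψ' : (S.subtype.comp φ).app _ (ComMag.ofTree K ComMag.cherryStars) =
      ofSet K {top _} := by
    rw [← map_ofSet_top e.symm, ← segment_eq hab hV, ← hψ,
      ← LinearOperad.map_symm_apply _ e (ComMag.ofTree K ComMag.cherryStars),
      (S.subtype.comp φ).natural, ComMag.map_ofTree, ← he]
    rfl
  refine ⟨φ.isoSymm fun W _ => ⟨?_, fun y => ?_⟩⟩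
  -- Injectivity is inherited from the composite with the inclusion into the graph operad.
  -- Surjectivity holds because the image of that composite is a suboperad containing the segment.
  · exact Function.Injective.of_comp (f := S.subtype.app W) (app_injective _ hψ' W)
  · obtain ⟨x, hx⟩ := LinearOperad.generated_le (P := graphOperad.{u, v} K)
      (S := (S.subtype.comp φ).range) (fun _ => ⟨_, hψ⟩) y.2
    exact ⟨x, Subtype.ext hx⟩

end graphOperad

end GraphOperad

open GraphOperad in
theorem mainTheorem8 {K : Type u} [Field K] [CharZero K] {V : Type v} [Finite V] (a b : V)
    (hab : a ≠ b) (hV : ∀ c, c = a ∨ c = b) :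
    Nonempty (((graphOperad.{u, v} K).generated (fun _ : Unit => V)
        (fun _ => graphOperad.segment K a b)).toOperad.Iso (ComMag.{v}.linearize K)) ∧
      (∀ σ : V ≃ V, (ComMag.{v}.linearize K).map σ (ComMag.generator K a b hab hV) =
        ComMag.generator K a b hab hV) ∧
      ∀ (P : LinearOperad.{u, v, w} K) (x : P.obj V), (∀ σ : V ≃ V, P.map σ x = x) →
        ∃! φ : (ComMag.{v}.linearize K).Hom P, φ.app V (ComMag.generator K a b hab hV) = x :=
  ⟨graphOperad.nonempty_iso hab hV, ComMag.map_generator hab hV,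
    fun _ x hx => ComMag.existsUnique_hom hab hV x hx⟩
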